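/- Let $\mathbb L/\mathbb K$ be a cyclic Galois extension of fields of degree $n$, let $\sigma$ be a generator of its Galois group, and let $R=\mathbb L[x;\sigma]$ be the skew polynomial ring with $xa=\sigma(a)x$ for $a\in\mathbb L$. Let $F(y)\in\mathbb K[y]$ be monic and irreducible with $F(y)\neq y$, let $s=\deg F$, let $F_0=F(0)$, let $m$ be the number of factors in a factorisation of the central element $F(x^n)$ into irreducible elements of $R$, and let $\ell=n/m$. Let $f$ be a monic irreducible divisor of $F(x^n)$ in $R$ with $f\notin Z(R)$, with constant coefficient $f_0$. Put $R_F=R/RF(x^n)$, $I(f)=\{g\in R: fg\in Rf\}$ and $\mathcal E(f)=I(f)/Rf$ (the eigenring of $f$), which acts on $R/Rf$ by right multiplication. Let $\rho\in\mathrm{Aut}(\mathbb L)$ be such that $\mathbb K$ has finite degree over $\mathbb K'=\mathrm{Fix}(\rho)\cap\mathbb K$. For $\eta\in\mathbb L$ and $k\ge 1$ let $$S_{n,s\ell,k}(\eta,\rho,F)=\{a_0+a_1x+\dots+a_{sk\ell-1}x^{sk\ell-1}+\eta a_0^{\rho}x^{sk\ell}+RF(x^n) : a_i\in\mathbb L\}\subseteq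 R_F .$$ Then $n=m\ell$, $\deg f=s\ell$, $\mathcal E(f)$ is a division ring, $R/Rf$ is a right $\mathcal E(f)$-vector space of dimension $m$, and for every right $\mathcal E(f)$-basis of $R/Rf$, taking the matrix of left multiplication on $R/Rf$ induces a $\mathbb K$-algebra isomorphism $R_F\cong M_m(\mathcal E(f))$. Moreover: (1) Let $1\le k<m$ and let $\eta\in\mathbb L$ satisfy $$N_{\mathbb L/\mathbb K'}(\eta)\,N_{\mathbb K/\mathbb K'}\big((-1)^{sk\ell(n-1)}F_0^{k\ell}\big)\neq 1 .$$ Then under each of these isomorphisms $S_{n,s\ell,k}(\eta,\rho,F)$ is a $\mathbb K'$-linear MRD code $\mathcal C$ in $M_m(\mathcal E(f))$ with minimum distance $d=m-k+1$. That is, $\mathcal C$ is a $\mathbb K'$-subspace, the minimum of $\mathrm{rk}(A-B)$ over distinct $A,B\in\mathcal C$ is $d$, where $\mathrm{rk}$ is the dimension of the right $\mathcal E(f)$-span of the columns, and $\dim_{\mathbb K'}\mathcal C=m(m-d+1)[\mathcal E(f):\mathbb K']$. (2) For every $\eta\in\mathbb L$, $N_{\mathbb L/\mathbb K'}(\eta)\,N_{\mathbb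 K/\mathbb K'}((-1)^{s\ell(n-1)}F_0^{\ell})=N_{\mathbb L/\mathbb K'}(\eta f_0)$. If this is different from $1$, there is a unique $\mathbb K'$-bilinear product $\star_S$ on $R/Rf$ with $$\Big((a_0-\eta a_0^{\rho}f_0)+\sum_{i=1}^{s\ell-1}a_ix^i\Big)\star_S b=\Big((a_0-\eta a_0^{\rho}f_0)+\sum_{i=1}^{s\ell-1}a_ix^i+\eta a_0^{\rho}f\Big)b \quad (\text{modulo } Rf)$$ for all $a_i\in\mathbb L$ and $b\in R$. The algebra $(R/Rf,\star_S)$ is a (not necessarily associative or unital) division algebra over $\mathbb K'$, that is, all left and right multiplications by nonzero elements are bijective. It has dimension $m\ell^2s[\mathbb K:\mathbb K']$, and its left multiplications are exactly the left multiplications on $R/Rf$ by the elements of $S_{n,s\ell,1}(\eta,\rho,F)$. It is isotopic, through $\mathbb K'$-linear maps, to a unital division algebra over $\mathbb K'$ on $R/Rf$. (3) In the situation of (2), there is $z\in Z(R)$ with $zx^{sn}\equiv 1\pmod{Rf}$, and for every such $z$ there is a unique $\mathbb K'$-bilinear product $\star_{S'}$ on $R/Rf$ with $$\Big((a_0-\eta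 a_0^{\rho}f_0)+\sum_{i=1}^{s\ell-1}a_ix^i\Big)\star_{S'} b=\Big((a_0-\eta a_0^{\rho}f_0)+\sum_{i=1}^{s\ell-1}a_ix^i+\eta a_0^{\rho}f\Big)zx^{sn-1}b \quad (\text{modulo } Rf)$$ for all $a_i\in\mathbb L$ and $b\in R$. The algebra $(R/Rf,\star_{S'})$ is a division algebra over $\mathbb K'$, isotopic to $(R/Rf,\star_S)$ through $\mathbb K'$-linear maps; if $s\ell>1$, it is unital with unity $x+Rf$. -/

import Mathlib

open Polynomial MulOpposite

noncomputable section

/-! ### The skew polynomial ring `L[x; σ]` -/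

section SkewRing

variable {K L : Type*} [Field K] [Field L] [Algebra K L]

/-- The action of the free monoid `{1, x, x², …}` on `L` in which `x` acts as `σ`. -/
@[reducible]
def skewAction (σ : L ≃ₐ[K] L) : MulSemiringAction (Multiplicative ℕ) L :=
  MulSemiringAction.compHom L (powersHom (L ≃ₐ[K] L) σ)

/-- The skew polynomial ring `L[x; σ]`: Mathlib's skew polynomials, with `x a = σ(a) x`. -/
def SkewPoly (σ : L ≃ₐ[K] L) : Type _ := SkewPolynomial L

namespace SkewPoly

variable (σ : L ≃ₐ[K] L)

instance instRing : Ring (SkewPoly σ) :=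
  letI := skewAction σ
  inferInstanceAs (Ring (SkewPolynomial L))

/-- The skew polynomial `a xⁱ`. -/
def monomial (i : ℕ) (a : L) : SkewPoly σ := SkewPolynomial.monomial i a

/-- The constant skew polynomial `a`. -/
def C (a : L) : SkewPoly σ := monomial σ 0 a

/-- The indeterminate `x`. -/
def X : SkewPoly σ := monomial σ 1 1

variable {σ}

/-- The coefficient of `xⁱ` (coefficients are written on the left). -/
def coeff (p : SkewPoly σ) (i : ℕ) : L := SkewPolynomial.coeff p i

/-- `p` has degree `d`. -/
def HasDegree (p : SkewPoly σ) (d : ℕ) : Prop :=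
  coeff p d ≠ 0 ∧ ∀ i, d < i → coeff p i = 0

/-- `p` has leading coefficient `1`. -/
def IsMonic (p : SkewPoly σ) : Prop :=
  ∃ d, coeff p d = 1 ∧ ∀ i, d < i → coeff p i = 0

variable (σ)

theorem monomial_add (i : ℕ) (a b : L) :
    monomial σ i (a + b) = monomial σ i a + monomial σ i b :=
  SkewPolynomial.monomial_add i a b

theorem monomial_mul_monomial (i j : ℕ) (a b : L) :
    monomial σ i a * monomial σ j b = monomial σ (i + j) (a * (σ ^ i) b) := by
  letI := skewAction σ
  have h := SkewPolynomial.monomial_mul_monomial i j a b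
  rw [SkewPolynomial.φ_iterate_apply] at h
  exact h

variable {σ}

theorem induction_on {motive : SkewPoly σ → Prop} (p : SkewPoly σ) (h0 : motive 0)
    (ha : ∀ p q, motive p → motive q → motive (p + q))
    (hm : ∀ i a, motive (monomial σ i a)) : motive p :=
  SkewPolynomial.induction (motive := motive) p h0
    (fun i a q _ _ hq => ha (monomial σ i a) q (hm i a) hq)

variable (σ)

theorem monomial_comm (i : ℕ) (c : K) (hi : σ ^ i = 1) (p : SkewPoly σ) :
    monomial σ i (algebraMap K L c) * p = p * monomial σ i (algebraMap K L c) := by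
  induction p using induction_on with
  | h0 => simp
  | ha p q hp hq => rw [mul_add, add_mul, hp, hq]
  | hm j a =>
    rw [monomial_mul_monomial, monomial_mul_monomial, hi, AlgEquiv.commutes, add_comm, mul_comm]
    simp

/-- The embedding of `K` in `L[x; σ]` as constants. -/
def constHom : K →+* SkewPoly σ where
  toFun c := C σ (algebraMap K L c)
  map_one' := by rw [map_one]; rfl
  map_mul' a b := by
    simp only [C]
    rw [monomial_mul_monomial]
    simp
  map_zero' := by rw [map_zero]; exact SkewPolynomial.monomial_zero_right 0
  map_add' a b := by
    simp only [C]
    rw [map_add, monomial_add]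

instance instAlgebra : Algebra K (SkewPoly σ) :=
  (constHom σ).toAlgebra' fun c p => monomial_comm σ 0 c (pow_zero σ) p

end SkewPoly

end SkewRing

open SkewPoly

/-! ### Central polynomials `F(xⁿ)` and the ring `R_F = R / R F(xⁿ)` -/

section Central

variable {K L : Type*} [Field K] [Field L] [Algebra K L] (σ : L ≃ₐ[K] L)

/-- The element `F(xⁿ)` of `L[x; σ]`, where `n = [L : K]`. -/
def centralPoly (F : K[X]) : SkewPoly σ :=
  F.sum fun i c => SkewPoly.monomial σ (Module.finrank K L * i) (algebraMap K L c)

theorem centralPoly_comm [FiniteDimensional K L] [IsGalois K L] (F : K[X]) (p : SkewPoly σ) :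
    centralPoly σ F * p = p * centralPoly σ F := by
  have hn : σ ^ Module.finrank K L = 1 := by
    rw [← IsGalois.card_aut_eq_finrank K L]
    exact pow_card_eq_one'
  simp only [centralPoly, Polynomial.sum_def, Finset.sum_mul, Finset.mul_sum]
  refine Finset.sum_congr rfl fun i _ => ?_
  exact SkewPoly.monomial_comm σ _ _ (by rw [pow_mul, hn, one_pow]) p

instance centralPoly_isTwoSided [FiniteDimensional K L] [IsGalois K L] (F : K[X]) :
    (Ideal.span {centralPoly σ F}).IsTwoSided where
  mul_mem_of_left {a} b ha := by
    obtain ⟨c, rfl⟩ := Ideal.mem_span_singleton'.1 ha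
    rw [mul_assoc, centralPoly_comm, ← mul_assoc]
    exact Ideal.mem_span_singleton'.2 ⟨c * b, rfl⟩

/-- The ring `R_F = R / R F(xⁿ)`. -/
abbrev CentralQuot (F : K[X]) : Type _ := SkewPoly σ ⧸ Ideal.span {centralPoly σ F}

/-- `p` is a product of exactly `m` irreducible elements. -/
def IsProductOfIrreducibles {R : Type*} [Monoid R] (p : R) (m : ℕ) : Prop :=
  ∃ l : List R, l.length = m ∧ (∀ q ∈ l, Irreducible q) ∧ l.prod = p

end Central

/-! ### The eigenring of `f` and the right eigenring-module `R / R f` -/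

section Eigenring

variable {K L : Type*} [Field K] [Field L] [Algebra K L] {σ : L ≃ₐ[K] L} (f : SkewPoly σ)

/-- The left `R`-module `R / R f`. -/
abbrev LeftQuot : Type _ := SkewPoly σ ⧸ Ideal.span {f}

/-- The class of `p` in `R / R f`. -/
def cls (p : SkewPoly σ) : LeftQuot f := Submodule.Quotient.mk p

/-- The idealiser `I(f) = {g ∈ R : f g ∈ R f}`. -/
def idealizer : Subalgebra K (SkewPoly σ) where
  carrier := {g | f * g ∈ Ideal.span {f}}
  mul_mem' {a b} ha hb := by
    obtain ⟨c, hc⟩ := Ideal.mem_span_singleton'.1 ha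
    show f * (a * b) ∈ Ideal.span {f}
    rw [← mul_assoc, ← hc, mul_assoc]
    exact Ideal.mul_mem_left _ c hb
  add_mem' {a b} ha hb := by
    show f * (a + b) ∈ Ideal.span {f}
    rw [mul_add]
    exact Ideal.add_mem _ ha hb
  algebraMap_mem' c := by
    show f * algebraMap K (SkewPoly σ) c ∈ Ideal.span {f}
    rw [← Algebra.commutes]
    exact Ideal.mul_mem_left _ _ (Ideal.mem_span_singleton_self f)

/-- `R f` as an ideal of `I(f)`. -/
def eigenIdeal : Ideal (idealizer f) := (Ideal.span {f}).comap (idealizer f).val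

instance eigenIdeal_isTwoSided : (eigenIdeal f).IsTwoSided where
  mul_mem_of_left {a} b ha := by
    show (a : SkewPoly σ) * (b : SkewPoly σ) ∈ Ideal.span {f}
    obtain ⟨c, hc⟩ := Ideal.mem_span_singleton'.1 (show (a : SkewPoly σ) ∈ Ideal.span {f} from ha)
    rw [← hc, mul_assoc]
    exact Ideal.mul_mem_left _ c b.2

/-- The eigenring `E(f) = I(f) / R f`. -/
abbrev Eigenring : Type _ := idealizer f ⧸ eigenIdeal f

/-- Right multiplication by `g ∈ I(f)` on `R / R f`. -/
def rightMul (g : idealizer f) : LeftQuot f →+ LeftQuot f :=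
  QuotientAddGroup.map _ _ (AddMonoidHom.mulRight (g : SkewPoly σ)) (by
    intro b hb
    obtain ⟨c, hc⟩ := Ideal.mem_span_singleton'.1 (show b ∈ Ideal.span {f} from hb)
    show b * (g : SkewPoly σ) ∈ Ideal.span {f}
    rw [← hc, mul_assoc]
    exact Ideal.mul_mem_left _ c g.2)

theorem rightMul_cls (g : idealizer f) (b : SkewPoly σ) :
    rightMul f g (cls f b) = cls f (b * g) := rfl

/-- The right action of `E(f)` on `R / R f` as an anti-homomorphism to the endomorphisms. -/
def eigenAction : Eigenring f →+ (LeftQuot f →+ LeftQuot f) :=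
  QuotientAddGroup.lift _
    { toFun := rightMul f
      map_zero' := by
        ext v
        obtain ⟨b, rfl⟩ := Submodule.Quotient.mk_surjective _ v
        show cls f (b * (0 : SkewPoly σ)) = 0
        rw [mul_zero]; rfl
      map_add' := fun g h => by
        ext v
        obtain ⟨b, rfl⟩ := Submodule.Quotient.mk_surjective _ v
        show cls f (b * ((g : SkewPoly σ) + h)) = cls f (b * g) + cls f (b * h)
        rw [mul_add]; rfl }
    (by
      intro g hg
      have hg' : (g : SkewPoly σ) ∈ Ideal.span {f} := hg
      show rightMul f g = 0
      ext v
      obtain ⟨b, rfl⟩ := Submodule.Quotient.mk_surjective _ v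
      show cls f (b * (g : SkewPoly σ)) = 0
      exact (Submodule.Quotient.mk_eq_zero _).2 (Ideal.mul_mem_left _ b hg'))

/-- `R / R f` as a right vector space over `E(f)`: `(b + R f) · (g + R f) = b g + R f`. -/
instance instRightModule : Module (Eigenring f)ᵐᵒᵖ (LeftQuot f) where
  smul α v := eigenAction f (unop α) v
  one_smul v := by
    obtain ⟨b, rfl⟩ := Submodule.Quotient.mk_surjective _ v
    show cls f (b * (1 : SkewPoly σ)) = cls f b
    rw [mul_one]
  mul_smul α β v := by
    obtain ⟨b, rfl⟩ := Submodule.Quotient.mk_surjective _ v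
    induction α using MulOpposite.rec' with | _ α => ?_
    induction β using MulOpposite.rec' with | _ β => ?_
    obtain ⟨g, rfl⟩ := Submodule.Quotient.mk_surjective _ α
    obtain ⟨h, rfl⟩ := Submodule.Quotient.mk_surjective _ β
    show cls f (b * ((h : SkewPoly σ) * g)) = cls f (b * h * g)
    rw [mul_assoc]
  smul_zero α := map_zero _
  smul_add α v w := map_add _ _ _
  add_smul α β v := by
    show eigenAction f (unop α + unop β) v = _
    rw [map_add]; rfl
  zero_smul v := by
    show eigenAction f 0 v = 0
    rw [map_zero]; rfl

theorem op_smul_cls (g : idealizer f) (b : SkewPoly σ) :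
    op (Ideal.Quotient.mk (eigenIdeal f) g) • cls f b = cls f (b * g) := rfl

end Eigenring

/-! ### Rank-metric codes over a division ring -/

section Codes

/-- The rank of a matrix over a division ring `D`: the dimension of the right `D`-vector space
generated by its columns. -/
def rightRank {D : Type*} [Ring D] {m : ℕ} (A : Matrix (Fin m) (Fin m) D) : ℕ :=
  Module.finrank Dᵐᵒᵖ (Submodule.span Dᵐᵒᵖ (Set.range A.col))

/-- `C` is a `k`-linear maximum rank distance code in `M_m(D)` with minimum distance `d`:
it is a `k`-subspace whose minimum distance is `d`, and it attains the Singleton-like bound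
`dim C ≤ m (m - d + 1) [D : k]`, where `[D : k]` is finite. -/
structure IsLinearMRDCode (k : Type*) {D : Type*} [Field k] [Ring D] [Algebra k D] {m : ℕ}
    (C : Set (Matrix (Fin m) (Fin m) D)) (d : ℕ) : Prop where
  finite : Module.Finite k D
  linear : ∃ W : Submodule k (Matrix (Fin m) (Fin m) D), (W : Set _) = C
  minDist : IsLeast {r | ∃ A ∈ C, ∃ B ∈ C, A ≠ B ∧ r = rightRank (A - B)} d
  le_size : d ≤ m
  dim : Module.finrank k (Submodule.span k C) = m * (m - d + 1) * Module.finrank k D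

end Codes

/-! ### Nonassociative algebra structures on a vector space -/

section Nonassoc

variable {k V : Type*} [Field k] [AddCommGroup V] [Module k V]

/-- `(V, ⋆)` is a division algebra: all left and right multiplications by nonzero elements are
invertible. -/
def IsDivisionProduct (star : V →ₗ[k] V →ₗ[k] V) : Prop :=
  ∀ a, a ≠ 0 → Function.Bijective (fun b => star a b) ∧ Function.Bijective (fun b => star b a)

/-- `e` is a two-sided unity of `(V, ⋆)`. -/
def IsUnity (star : V →ₗ[k] V →ₗ[k] V) (e : V) : Prop :=
  ∀ a, star e a = a ∧ star a e = a

/-- `(V, ⋆)` and `(V, ⋆')` are isotopic, through `k`-linear maps. -/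
def IsIsotopic (star star' : V →ₗ[k] V →ₗ[k] V) : Prop :=
  ∃ h₁ h₂ h₃ : V ≃ₗ[k] V, ∀ a b, h₁ (star a b) = star' (h₂ a) (h₃ b)

end Nonassoc

/-! ### The twisted codes and products -/

section Twisted

variable {K L : Type*} [Field K] [Field L] [Algebra K L]

/-- The field `K' = Fix(ρ) ∩ K`, as a subfield of `K`. -/
def fixedSubfield (K : Type*) {L : Type*} [Field K] [Field L] [Algebra K L] (ρ : L ≃+* L) :
    Subfield K :=
  ((ρ : L →+* L).comp (algebraMap K L)).eqLocusField (algebraMap K L)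

variable (σ : L ≃ₐ[K] L) (ρ : L ≃+* L) (η : L)

/-- The skew polynomials `a₀ + a₁ x + ⋯ + a_{d-1} x^{d-1} + η ρ(a₀) x^d`. -/
def twistedPolys (d : ℕ) : Set (SkewPoly σ) :=
  {p | ∃ a : ℕ → L,
    p = ∑ i ∈ Finset.range d, SkewPoly.monomial σ i (a i) + SkewPoly.monomial σ d (η * ρ (a 0))}

/-- The code `S_{n,sℓ,k}(η, ρ, F)` in `R_F`, where `d = skℓ`. -/
def twistedCode [FiniteDimensional K L] [IsGalois K L] (F : K[X]) (d : ℕ) :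
    Set (CentralQuot σ F) :=
  Ideal.Quotient.mk (Ideal.span {centralPoly σ F}) '' twistedPolys σ ρ η d

variable {σ}

/-- The skew polynomial `(a₀ - η ρ(a₀) f₀) + a₁ x + ⋯ + a_{d-1} x^{d-1}`. -/
def twistRep (f : SkewPoly σ) (d : ℕ) (a : ℕ → L) : SkewPoly σ :=
  SkewPoly.C σ (a 0 - η * ρ (a 0) * f.coeff 0) +
    ∑ i ∈ Finset.Ico 1 d, SkewPoly.monomial σ i (a i)

/-- The skew polynomial `(a₀ - η ρ(a₀) f₀) + a₁ x + ⋯ + a_{d-1} x^{d-1} + η ρ(a₀) f`. -/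
def twistLift (f : SkewPoly σ) (d : ℕ) (a : ℕ → L) : SkewPoly σ :=
  twistRep ρ η f d a + SkewPoly.C σ (η * ρ (a 0)) * f

/-- The product `star` on `R / R f` sends the classes of `twistRep a` and `b` to the class of
`twistLift a * w * b`. -/
def IsTwistedProduct (f w : SkewPoly σ) (d : ℕ)
    (star : LeftQuot f →ₗ[fixedSubfield K ρ] LeftQuot f →ₗ[fixedSubfield K ρ] LeftQuot f) : Prop :=
  ∀ (a : ℕ → L) (b : SkewPoly σ),
    star (cls f (twistRep ρ η f d a)) (cls f b) = cls f (twistLift ρ η f d a * w * b)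

end Twisted

end

noncomputable section

namespace SkewPoly

variable {K L : Type*} [Field K] [Field L] [Algebra K L] {σ : L ≃ₐ[K] L}

/-! ### Coefficients and degrees of skew polynomials -/

/-! Write `R = L[x; σ]` and let `h` be a monic right divisor of `F(xⁿ)` of degree `d`. On `R / R h`,
with `L`-basis `1, …, x^(d-1)`, `x` acts semilinearly through the companion matrix `A` of `h`, and
`xⁿ` acts `L`-linearly through a matrix `B` with `F(B) = 0` and `det B = N(det A)`. Since `B` is
similar to `σ(B)`, its characteristic polynomial lies in `K[y]`; as it divides a power of `F`, it is
`F^j`. Degree and constant term give `d = s j` and the norm of `h₀` up to sign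
(`norm_coeff_zero_of_dvd`).

For irreducible `f` the module `R / R f` is simple with endomorphisms given by `E(f)`, and its
annihilator is `R F(xⁿ)` (`mem_span_centralPoly_of_smul_eq_zero`). Jacobson density
(`exists_smul_eq_of_linearIndependent`) then yields `R_F ≅ M_m(E(f))` (`exists_algEquiv`). Comparing
lengths and `L`-dimensions identifies `m` and `deg f`.

If a nonzero twisted polynomial `p` of degree at most `k deg f` killed `k` independent vectors,
density and a dimension count would make `R / R p` isomorphic to `(R / R f)^k`. Then `p` would have
degree exactly `k deg f` and right-divide `F(xⁿ)`, and the norm formula for its monic multiple would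
contradict the hypothesis on `η` (`eq_zero_of_twistedMap_smul_eq_zero`). This is the rank bound of
the MRD property. For `k = 1` it says that nonzero twisted polynomials act invertibly on `R / R f`.
They form a system of representatives modulo `R f` (`exists_twisted_section`), hence define a
division product. Kaplansky's trick, or a factor `z x^(sn-1)` inverse to `x`, makes it unital. -/

theorem ext {p q : SkewPoly σ} (h : ∀ i, coeff p i = coeff q i) : p = q :=
  SkewMonoidAlgebra.ext fun a => h a

theorem coeff_add (p q : SkewPoly σ) (i : ℕ) : coeff (p + q) i = coeff p i + coeff q i := by
  exact DFunLike.congr_fun (SkewMonoidAlgebra.coeff_add (G := Multiplicative ℕ) (k := L) p q) _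

/-- The `i`-th coefficient as an additive map. -/
def coeffHom (σ : L ≃ₐ[K] L) (i : ℕ) : SkewPoly σ →+ L :=
  AddMonoidHom.mk' (fun p => coeff p i) fun p q => coeff_add p q i

theorem coeff_zero (i : ℕ) : coeff (0 : SkewPoly σ) i = 0 := map_zero (coeffHom σ i)

theorem coeff_sub (p q : SkewPoly σ) (i : ℕ) : coeff (p - q) i = coeff p i - coeff q i :=
  map_sub (coeffHom σ i) p q

theorem coeff_sum {ι : Type*} (s : Finset ι) (p : ι → SkewPoly σ) (i : ℕ) :
    coeff (∑ j ∈ s, p j) i = ∑ j ∈ s, coeff (p j) i :=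
  map_sum (coeffHom σ i) p s

theorem coeff_monomial (i j : ℕ) (a : L) : coeff (monomial σ i a) j = if i = j then a else 0 :=
  SkewPolynomial.coeff_monomial

/-- The monomials of a fixed degree as an additive map. -/
def monomialHom (σ : L ≃ₐ[K] L) (i : ℕ) : L →+ SkewPoly σ :=
  AddMonoidHom.mk' (monomial σ i) (monomial_add σ i)

theorem monomial_zero (i : ℕ) : monomial σ i 0 = 0 := map_zero (monomialHom σ i)

theorem X_pow (i : ℕ) : X σ ^ i = monomial σ i 1 := by
  induction i with
  | zero => rfl
  | succ i ih => rw [pow_succ, ih, X, monomial_mul_monomial]; simp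

theorem coeff_mul (p q : SkewPoly σ) (k : ℕ) :
    coeff (p * q) k =
      ∑ x ∈ Finset.HasAntidiagonal.antidiagonal k, coeff p x.1 * (σ ^ x.1) (coeff q x.2) := by
  induction p using induction_on with
  | h0 => simp [coeff_zero]
  | ha p p' hp hp' => simp [add_mul, coeff_add, hp, hp', Finset.sum_add_distrib]
  | hm i a =>
    induction q using induction_on with
    | h0 => simp [coeff_zero]
    | ha q q' hq hq' => simp [mul_add, coeff_add, hq, hq', Finset.sum_add_distrib]
    | hm j b =>
      rw [monomial_mul_monomial, coeff_monomial]
      simp only [coeff_monomial]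
      split_ifs with h
      · rw [Finset.sum_eq_single (i, j)]
        · simp
        · rintro ⟨x, y⟩ - hx
          by_cases h1 : i = x
          · have h2 : j ≠ y := fun h2 => hx (by rw [h1, h2])
            simp [h2]
          · simp [h1]
        · intro h'
          exact absurd (Finset.HasAntidiagonal.mem_antidiagonal.2 h) h'
      · refine (Finset.sum_eq_zero ?_).symm
        rintro ⟨x, y⟩ hx
        rw [Finset.HasAntidiagonal.mem_antidiagonal] at hx
        by_cases h1 : i = x
        · have h2 : j ≠ y := fun h2 => h (by rw [h1, h2]; exact hx)
          simp [h2]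
        · simp [h1]

theorem coeff_monomial_mul (i j : ℕ) (a : L) (p : SkewPoly σ) :
    coeff (monomial σ i a * p) (i + j) = a * (σ ^ i) (coeff p j) := by
  rw [coeff_mul, Finset.sum_eq_single (i, j)]
  · simp [coeff_monomial]
  · rintro ⟨x, y⟩ hx hne
    rw [Finset.HasAntidiagonal.mem_antidiagonal] at hx
    have : i ≠ x := by
      rintro rfl
      exact hne (by simp_all)
    simp [coeff_monomial, this]
  · simp

theorem coeff_C_mul (j : ℕ) (a : L) (p : SkewPoly σ) : coeff (C σ a * p) j = a * coeff p j := by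
  have h := coeff_monomial_mul 0 j a p
  rwa [zero_add] at h

theorem coeff_mul_C (j : ℕ) (a : L) (p : SkewPoly σ) :
    coeff (p * C σ a) j = coeff p j * (σ ^ j) a := by
  rw [coeff_mul, Finset.sum_eq_single (j, 0)]
  · simp [C, coeff_monomial]
  · rintro ⟨x, y⟩ hx hne
    rw [Finset.HasAntidiagonal.mem_antidiagonal] at hx
    have : 0 ≠ y := by
      rintro rfl
      exact hne (by simp_all)
    simp [C, coeff_monomial, this]
  · simp

theorem coeff_mul_X_succ (j : ℕ) (p : SkewPoly σ) : coeff (p * X σ) (j + 1) = coeff p j := by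
  rw [coeff_mul, Finset.sum_eq_single (j, 1)]
  · simp [X, coeff_monomial]
  · rintro ⟨x, y⟩ hx hne
    rw [Finset.HasAntidiagonal.mem_antidiagonal] at hx
    have : 1 ≠ y := by
      rintro rfl
      exact hne (by simp_all)
    simp [X, coeff_monomial, this]
  · simp

theorem coeff_mul_X_zero (p : SkewPoly σ) : coeff (p * X σ) 0 = 0 := by
  simp [coeff_mul, X, coeff_monomial]

theorem coeff_mul_zero (p q : SkewPoly σ) : coeff (p * q) 0 = coeff p 0 * coeff q 0 := by
  simp [coeff_mul]

theorem exists_coeff_eq_zero (p : SkewPoly σ) : ∃ N, ∀ i, N ≤ i → coeff p i = 0 := by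
  induction p using induction_on with
  | h0 => exact ⟨0, fun i _ => coeff_zero i⟩
  | ha p q hp hq =>
    obtain ⟨M, hM⟩ := hp
    obtain ⟨N, hN⟩ := hq
    refine ⟨max M N, fun i hi => ?_⟩
    rw [coeff_add, hM i (le_trans (le_max_left _ _) hi), hN i (le_trans (le_max_right _ _) hi),
      add_zero]
  | hm i a => exact ⟨i + 1, fun j hj => by rw [coeff_monomial, if_neg (by omega)]⟩

theorem exists_hasDegree {p : SkewPoly σ} (hp : p ≠ 0) : ∃ d, p.HasDegree d := by
  classical
  have h := exists_coeff_eq_zero p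
  have hpos : Nat.find h ≠ 0 := fun h0 => hp (ext fun i => by
    rw [coeff_zero]; exact Nat.find_spec h i (by omega))
  obtain ⟨d, hd⟩ := Nat.exists_eq_succ_of_ne_zero hpos
  refine ⟨d, fun h0 => ?_, fun i hi => Nat.find_spec h i (by omega)⟩
  refine Nat.find_min h (m := d) (by omega) fun i hi => ?_
  rcases eq_or_lt_of_le hi with rfl | hi
  · exact h0
  · exact Nat.find_spec h i (by omega)

theorem HasDegree.ne_zero {p : SkewPoly σ} {d : ℕ} (hp : p.HasDegree d) : p ≠ 0 := by
  rintro rfl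
  exact hp.1 (coeff_zero d)

theorem coeff_mul_add {p q : SkewPoly σ} {d e : ℕ} (hp : ∀ i, d < i → coeff p i = 0)
    (hq : ∀ i, e < i → coeff q i = 0) :
    coeff (p * q) (d + e) = coeff p d * (σ ^ d) (coeff q e) := by
  rw [coeff_mul, Finset.sum_eq_single (d, e)]
  · rintro ⟨x, y⟩ hx hne
    rw [Finset.HasAntidiagonal.mem_antidiagonal] at hx
    simp only at hx ⊢
    rcases lt_trichotomy d x with h | h | h
    · rw [hp x h, zero_mul]
    · subst h
      exact absurd (by simp_all) hne
    · rw [hq y (by omega), map_zero, mul_zero]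
  · simp

theorem coeff_mul_eq_zero {p q : SkewPoly σ} {d e : ℕ} (hp : ∀ i, d < i → coeff p i = 0)
    (hq : ∀ i, e < i → coeff q i = 0) (k : ℕ) (hk : d + e < k) : coeff (p * q) k = 0 := by
  rw [coeff_mul]
  refine Finset.sum_eq_zero ?_
  rintro ⟨x, y⟩ hx
  rw [Finset.HasAntidiagonal.mem_antidiagonal] at hx
  simp only at hx ⊢
  by_cases h : d < x
  · rw [hp x h, zero_mul]
  · rw [hq y (by omega), map_zero, mul_zero]

theorem HasDegree.mul {p q : SkewPoly σ} {d e : ℕ} (hp : p.HasDegree d) (hq : q.HasDegree e) :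
    (p * q).HasDegree (d + e) := by
  refine ⟨?_, coeff_mul_eq_zero hp.2 hq.2⟩
  rw [coeff_mul_add hp.2 hq.2]
  exact mul_ne_zero hp.1 ((map_ne_zero_iff _ (σ ^ d).injective).2 hq.1)

instance : NoZeroDivisors (SkewPoly σ) where
  eq_zero_or_eq_zero_of_mul_eq_zero {p q} h := by
    by_contra! hne
    obtain ⟨d, hd⟩ := exists_hasDegree hne.1
    obtain ⟨e, he⟩ := exists_hasDegree hne.2
    exact (hd.mul he).ne_zero h

theorem hasDegree_monomial (i : ℕ) {a : L} (ha : a ≠ 0) : (monomial σ i a).HasDegree i :=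
  ⟨by simpa [coeff_monomial] using ha, fun j hj => by rw [coeff_monomial, if_neg (by omega)]⟩

instance : Nontrivial (SkewPoly σ) :=
  ⟨1, 0, (hasDegree_monomial 0 one_ne_zero).ne_zero⟩

theorem IsMonic.exists_hasDegree {p : SkewPoly σ} (hp : p.IsMonic) :
    ∃ d, p.HasDegree d ∧ coeff p d = 1 := by
  obtain ⟨d, h1, h2⟩ := hp
  exact ⟨d, ⟨by simp [h1], h2⟩, h1⟩

/-! ### Division with remainder, principal left ideals and coordinates on `R / R f`. -/

/-- Constants as a ring homomorphism. -/
def CHom (σ : L ≃ₐ[K] L) : L →+* SkewPoly σ where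
  toFun := C σ
  map_one' := rfl
  map_mul' a b := by simp [C, monomial_mul_monomial]
  map_zero' := monomial_zero 0
  map_add' := monomial_add σ 0

instance instModule : Module L (SkewPoly σ) := Module.compHom _ (CHom σ)

theorem smul_def (a : L) (p : SkewPoly σ) : a • p = C σ a * p := rfl

theorem algebraMap_def (c : K) : algebraMap K (SkewPoly σ) c = C σ (algebraMap K L c) := rfl

instance : IsScalarTower L (SkewPoly σ) (SkewPoly σ) :=
  ⟨fun a p q => by simp only [smul_def, smul_eq_mul, mul_assoc]⟩

instance : IsScalarTower K L (SkewPoly σ) :=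
  ⟨fun c a p => by
    rw [smul_def, smul_def, Algebra.smul_def c (C σ a * p), algebraMap_def, ← mul_assoc,
      Algebra.smul_def]
    congr 1
    exact map_mul (CHom σ) _ _⟩

instance (k : Subfield K) : IsScalarTower k L (SkewPoly σ) :=
  ⟨fun c a p => smul_assoc (c : K) a p⟩

theorem C_mul_monomial (i : ℕ) (a b : L) : C σ a * monomial σ i b = monomial σ i (a * b) := by
  simp [C, monomial_mul_monomial]

theorem smul_monomial (i : ℕ) (a b : L) : a • monomial σ i b = monomial σ i (a * b) :=
  C_mul_monomial i a b

theorem isUnit_C {a : L} (ha : a ≠ 0) : IsUnit (C σ a) := (IsUnit.mk0 a ha).map (CHom σ)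

/-- Right division with remainder. -/
theorem exists_eq_mul_add {f : SkewPoly σ} {d : ℕ} (hf : f.HasDegree d) (p : SkewPoly σ) :
    ∃ q r, p = q * f + r ∧ ∀ i, d ≤ i → coeff r i = 0 := by
  obtain ⟨N, hN⟩ := exists_coeff_eq_zero p
  induction N generalizing p with
  | zero => exact ⟨0, p, by simp, fun i _ => hN i (Nat.zero_le i)⟩
  | succ N ih =>
    by_cases hd : d ≤ N
    · obtain ⟨e, rfl⟩ := Nat.exists_eq_add_of_le' hd
      -- Chosen so that `c x^e f` has the same coefficient as `p` in degree `e + d`.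
      set c := coeff p (e + d) * ((σ ^ e) (coeff f d))⁻¹
      have hne : (σ ^ e) (coeff f d) ≠ 0 :=
        (map_ne_zero_iff _ (σ ^ e).injective).2 hf.1
      obtain ⟨q, r, h, hr⟩ := ih (p - monomial σ e c * f) (by
        intro i hi
        rcases eq_or_lt_of_le hi with rfl | hi
        · rw [coeff_sub, coeff_monomial_mul, mul_assoc, inv_mul_cancel₀ hne, mul_one, sub_self]
        · rw [coeff_sub, hN i hi, coeff_mul_eq_zero (d := e) _ hf.2 i hi, sub_zero]
          intro j hj
          rw [coeff_monomial, if_neg (by omega)])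
      exact ⟨q + monomial σ e c, r, by rw [add_mul, add_right_comm, ← h]; abel, hr⟩
    · exact ⟨0, p, by simp, fun i hi => hN i (by omega)⟩

theorem eq_zero_of_mem_span {f r : SkewPoly σ} {d : ℕ} (hf : f.HasDegree d)
    (hr : ∀ i, d ≤ i → coeff r i = 0) (hmem : r ∈ Ideal.span {f}) : r = 0 := by
  obtain ⟨q, rfl⟩ := Ideal.mem_span_singleton'.1 hmem
  by_contra hne
  obtain ⟨e, he⟩ := exists_hasDegree (left_ne_zero_of_mul hne)
  exact (he.mul hf).1 (hr _ (by omega))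

/-- Every nonzero left ideal is generated by a monic skew polynomial. -/
theorem exists_monic_span_eq (J : Ideal (SkewPoly σ)) (hJ : J ≠ ⊥) :
    ∃ g d, HasDegree g d ∧ coeff g d = 1 ∧ J = Ideal.span {g} := by
  classical
  obtain ⟨p, hpJ, hp⟩ := Submodule.exists_mem_ne_zero_of_ne_bot hJ
  obtain ⟨e, he⟩ := exists_hasDegree hp
  have hex : ∃ d, ∃ p ∈ J, HasDegree p d := ⟨e, p, hpJ, he⟩
  obtain ⟨g, hgJ, hg⟩ := Nat.find_spec hex
  set d := Nat.find hex
  refine ⟨C σ (coeff g d)⁻¹ * g, d, ?_, ?_, ?_⟩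
  · have h := (hasDegree_monomial (σ := σ) 0 (inv_ne_zero hg.1)).mul hg
    rwa [zero_add] at h
  · rw [coeff_C_mul, inv_mul_cancel₀ hg.1]
  · rw [Ideal.span_singleton_mul_left_unit (isUnit_C (inv_ne_zero hg.1))]
    refine le_antisymm (fun p hp => ?_) ((Ideal.span_singleton_le_iff_mem _).2 hgJ)
    obtain ⟨q, r, h, hr⟩ := exists_eq_mul_add hg p
    have hrJ : r ∈ J := by
      have : r = p - q * g := by rw [h]; abel
      rw [this]
      exact J.sub_mem hp (J.mul_mem_left q hgJ)
    by_cases hr0 : r = 0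
    · exact Ideal.mem_span_singleton'.2 ⟨q, by rw [h, hr0, add_zero]⟩
    · obtain ⟨k, hk⟩ := exists_hasDegree hr0
      have hkd : k < d := by
        by_contra hcon
        exact hk.1 (hr k (by omega))
      exact absurd ⟨r, hrJ, hk⟩ (Nat.find_min hex hkd)

/-- The skew polynomial with coefficients `v 0, …, v (d - 1)`. -/
def ofCoeffs (σ : L ≃ₐ[K] L) (d : ℕ) : (Fin d → L) →ₗ[L] SkewPoly σ where
  toFun v := ∑ i : Fin d, monomial σ i (v i)
  map_add' v w := by simp [monomial_add, Finset.sum_add_distrib]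
  map_smul' a v := by simp [Finset.smul_sum, smul_monomial]

theorem coeff_ofCoeffs {d : ℕ} (v : Fin d → L) (i : Fin d) :
    coeff (ofCoeffs σ d v) i = v i := by
  simp [ofCoeffs, coeff_sum, coeff_monomial, Fin.val_inj]

theorem coeff_ofCoeffs_of_le {d : ℕ} (v : Fin d → L) {i : ℕ} (hi : d ≤ i) :
    coeff (ofCoeffs σ d v) i = 0 := by
  simp only [ofCoeffs, LinearMap.coe_mk, AddHom.coe_mk, coeff_sum, coeff_monomial]
  exact Finset.sum_eq_zero fun j _ => if_neg (by omega)

theorem ofCoeffs_coeff {d : ℕ} {p : SkewPoly σ} (hp : ∀ i, d ≤ i → coeff p i = 0) :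
    ofCoeffs σ d (fun i => coeff p i) = p := by
  refine ext fun i => ?_
  by_cases hi : i < d
  · exact coeff_ofCoeffs (fun i : Fin d => coeff p i) ⟨i, hi⟩
  · rw [coeff_ofCoeffs_of_le _ (not_lt.1 hi), hp i (not_lt.1 hi)]

theorem ofCoeffs_injective (d : ℕ) : Function.Injective (ofCoeffs σ d) := fun v w h =>
  funext fun i => by rw [← coeff_ofCoeffs (σ := σ) v i, h, coeff_ofCoeffs]

/-- The coordinates of `R / R f` with respect to `1, x, …, x ^ (d - 1)`, where `d = deg f`. -/
def quotEquiv {f : SkewPoly σ} {d : ℕ} (hf : f.HasDegree d) : (Fin d → L) ≃ₗ[L] LeftQuot f :=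
  LinearEquiv.ofBijective
    (((Submodule.mkQ (Ideal.span {f})).restrictScalars L).comp (ofCoeffs σ d)) <| by
    constructor
    · refine (injective_iff_map_eq_zero _).2 fun v hv => ?_
      have h : ofCoeffs σ d v ∈ Ideal.span {f} := (Submodule.Quotient.mk_eq_zero _).1 hv
      have h0 := eq_zero_of_mem_span hf (fun i hi => coeff_ofCoeffs_of_le v hi) h
      exact ofCoeffs_injective d (h0.trans (map_zero _).symm)
    · intro v
      obtain ⟨p, rfl⟩ := Submodule.Quotient.mk_surjective _ v
      obtain ⟨q, r, h, hr⟩ := exists_eq_mul_add hf p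
      refine ⟨fun i => coeff r i, ?_⟩
      show Submodule.Quotient.mk (ofCoeffs σ d fun i => coeff r i) = _
      rw [ofCoeffs_coeff hr, Submodule.Quotient.eq, h, sub_add_cancel_right]
      exact neg_mem (Ideal.mem_span_singleton'.2 ⟨q, rfl⟩)

theorem quotEquiv_apply {f : SkewPoly σ} {d : ℕ} (hf : f.HasDegree d) (v : Fin d → L) :
    quotEquiv hf v = cls f (ofCoeffs σ d v) := rfl

theorem finrank_leftQuot {f : SkewPoly σ} {d : ℕ} (hf : f.HasDegree d) :
    Module.finrank L (LeftQuot f) = d := by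
  rw [← (quotEquiv hf).finrank_eq, Module.finrank_fin_fun]

theorem finite_leftQuot {f : SkewPoly σ} (hf : f ≠ 0) : Module.Finite L (LeftQuot f) := by
  obtain ⟨d, hd⟩ := exists_hasDegree hf
  exact Module.Finite.equiv (quotEquiv hd)

theorem cls_eq_zero {f p : SkewPoly σ} : cls f p = 0 ↔ p ∈ Ideal.span {f} :=
  Submodule.Quotient.mk_eq_zero _

theorem cls_surjective (f : SkewPoly σ) : Function.Surjective (cls f) :=
  Submodule.Quotient.mk_surjective _

theorem smul_cls (f p q : SkewPoly σ) : p • cls f q = cls f (p * q) := rfl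

end SkewPoly

/-! ### Characteristic polynomials and semilinear maps -/

section Matrices

/-- The ring is noncommutative, so divisibility means a cofactor on the right. With `u = X` scalar
and `v = B` it gives `p(X) - p(B) = (X - B) Q`. -/
theorem Commute.sub_dvd_aeval_sub_aeval {R A : Type*} [CommRing R] [Ring A] [Algebra R A] {u v : A}
    (h : Commute u v) (p : R[X]) : u - v ∣ aeval u p - aeval v p := by
  induction p using Polynomial.induction_on' with
  | add p q hp hq =>
    rw [map_add, map_add, add_sub_add_comm]
    exact dvd_add hp hq
  | monomial i c =>
    obtain ⟨w, hw⟩ := h.sub_dvd_pow_sub_pow i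
    refine ⟨c • w, ?_⟩
    rw [aeval_monomial, aeval_monomial, ← Algebra.smul_def, ← Algebra.smul_def, ← smul_sub, hw,
      mul_smul_comm]

/-- When `p(B) = 0`, the scalar matrix `p(X)` factors as `(X - B) Q`; take determinants. -/
theorem Matrix.charpoly_dvd_pow_of_aeval_eq_zero {R ι : Type*} [CommRing R] [Fintype ι]
    [DecidableEq ι] (B : Matrix ι ι R) (p : R[X]) (h : aeval B p = 0) :
    B.charpoly ∣ p ^ Fintype.card ι := by
  have hU : aeval (Matrix.scalar ι (Polynomial.X : R[X])) p = Matrix.scalar ι p := by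
    have h1 := Polynomial.aeval_algebraMap_apply (R := R) (Matrix ι ι R[X]) (Polynomial.X : R[X]) p
    rwa [aeval_X_left_apply] at h1
  have hV : aeval (Polynomial.C.mapMatrix B) p = 0 := by
    have h1 := Polynomial.aeval_algHom_apply
      ((Algebra.ofId R R[X]).mapMatrix (m := ι)) B p
    rw [h, map_zero] at h1
    exact h1
  obtain ⟨Q, hQ⟩ := Commute.sub_dvd_aeval_sub_aeval (R := R)
    (Matrix.scalar_commute (Polynomial.X : R[X]) (fun r => Commute.all _ r)
      (Polynomial.C.mapMatrix B)) p
  rw [hU, hV, sub_zero] at hQ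
  refine ⟨Q.det, ?_⟩
  rw [Matrix.charpoly, Matrix.charmatrix, ← Matrix.det_mul, ← hQ]
  simp

variable {K L : Type*} [Field K] [Field L] [Algebra K L]

/-- The matrix of the `k`-th power of the semilinear map with matrix `A`. -/
def semilinearPow (σ : L ≃ₐ[K] L) {d : ℕ} (A : Matrix (Fin d) (Fin d) L) :
    ℕ → Matrix (Fin d) (Fin d) L
  | 0 => 1
  | k + 1 => A * (semilinearPow σ A k).map σ

/-- The definition peels a factor `A` off the left, this peels a twisted copy off the right.
Comparing both at `k = n`, where `σⁿ = 1`, gives `A σ(B) = B A` for `B` the `n`-th power. -/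
theorem semilinearPow_succ (σ : L ≃ₐ[K] L) {d : ℕ} (A : Matrix (Fin d) (Fin d) L) (k : ℕ) :
    semilinearPow σ A (k + 1) = semilinearPow σ A k * A.map (σ ^ k : L ≃ₐ[K] L) := by
  induction k with
  | zero =>
    have h : (1 : Matrix (Fin d) (Fin d) L).map σ = 1 := Matrix.map_one _ (map_zero σ) (map_one σ)
    simp only [semilinearPow, h, pow_zero, mul_one, one_mul]
    rfl
  | succ k ih =>
    conv_lhs => rw [semilinearPow, ih, Matrix.map_mul, ← mul_assoc]
    congr 1
    ext i j
    simp only [Matrix.map_apply, pow_succ']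
    rfl

theorem det_semilinearPow (σ : L ≃ₐ[K] L) {d : ℕ} (A : Matrix (Fin d) (Fin d) L) (k : ℕ) :
    (semilinearPow σ A k).det = ∏ i ∈ Finset.range k, (σ ^ i) A.det := by
  induction k with
  | zero => simp [semilinearPow]
  | succ k ih =>
    rw [semilinearPow_succ, Matrix.det_mul, ih, Finset.prod_range_succ]
    congr 1
    exact (RingHom.map_det ((σ ^ k : L ≃ₐ[K] L) : L →+* L) A).symm

variable [FiniteDimensional K L] [IsGalois K L] {σ : L ≃ₐ[K] L}

theorem orderOf_eq_finrank (hσ : Subgroup.zpowers σ = ⊤) : orderOf σ = Module.finrank K L := by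
  rw [← IsGalois.card_aut_eq_finrank K L, ← Nat.card_zpowers, hσ]
  exact Nat.card_congr Subgroup.topEquiv.toEquiv

theorem pow_finrank_eq_one (σ : L ≃ₐ[K] L) : σ ^ Module.finrank K L = 1 := by
  rw [← IsGalois.card_aut_eq_finrank K L]
  exact pow_card_eq_one'

theorem algebraMap_norm_eq_prod_range (hσ : Subgroup.zpowers σ = ⊤) (a : L) :
    algebraMap K L (Algebra.norm K a) =
      ∏ i ∈ Finset.range (Module.finrank K L), (σ ^ i) a := by
  rw [Algebra.norm_eq_prod_automorphisms, ← orderOf_eq_finrank hσ, ← Fin.prod_univ_eq_prod_range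
    fun i => (σ ^ i) a]
  refine (Fintype.prod_equiv ((finEquivZPowers (isOfFinOrder_of_finite σ)).trans
    ((Equiv.setCongr (congrArg _ hσ)).trans Subgroup.topEquiv.toEquiv)) _ _ fun i => ?_).symm
  show _ = (finEquivZPowers (isOfFinOrder_of_finite σ) i : L ≃ₐ[K] L) a
  rw [finEquivZPowers_apply]

theorem mem_range_algebraMap_of_apply_eq (hσ : Subgroup.zpowers σ = ⊤) {a : L} (ha : σ a = a) :
    a ∈ Set.range (algebraMap K L) := by
  rw [IsGalois.mem_range_algebraMap_iff_fixed]
  intro τ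
  have hle : Subgroup.zpowers σ ≤ MulAction.stabilizer (L ≃ₐ[K] L) a :=
    (Subgroup.zpowers_le).2 ha
  rw [hσ] at hle
  exact hle (Subgroup.mem_top τ)

/-- The characteristic polynomial of `B`, the matrix of the `n`-th power, is `σ`-invariant and
divides `F^d`, so it is a power `F^j` of the irreducible `F`. Its degree is `d`, and its constant
term is `det B = N(det A)` up to sign. -/
theorem semilinearPow_charpoly (hσ : Subgroup.zpowers σ = ⊤) {d : ℕ}
    (A : Matrix (Fin d) (Fin d) L) (F : K[X]) (hFm : F.Monic) (hFi : Irreducible F)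
    (hF0 : F.coeff 0 ≠ 0) (hB : aeval (semilinearPow σ A (Module.finrank K L)) F = 0) :
    ∃ j, d = F.natDegree * j ∧
      Algebra.norm K A.det = (-1) ^ d * F.coeff 0 ^ j := by
  set n := Module.finrank K L with hn
  set B := semilinearPow σ A n with hBdef
  have hdetB : B.det = algebraMap K L (Algebra.norm K A.det) := by
    rw [algebraMap_norm_eq_prod_range hσ, hBdef, det_semilinearPow]
  have hBF : aeval B (F.map (algebraMap K L)) = 0 := by rw [aeval_map_algebraMap, hB]
  have hdvd := Matrix.charpoly_dvd_pow_of_aeval_eq_zero B _ hBF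
  rw [Fintype.card_fin] at hdvd
  have hcoeff : B.charpoly.coeff 0 ≠ 0 := by
    intro h0
    obtain ⟨q, hq⟩ := hdvd
    have h1 := congrArg (Polynomial.eval 0) hq
    rw [Polynomial.eval_mul, ← Polynomial.coeff_zero_eq_eval_zero B.charpoly, h0, zero_mul,
      Polynomial.eval_pow, ← Polynomial.coeff_zero_eq_eval_zero, Polynomial.coeff_map] at h1
    exact pow_ne_zero d ((_root_.map_ne_zero _).2 hF0) h1
  have hBunit : B.det ≠ 0 := by
    rw [Matrix.det_eq_sign_charpoly_coeff]
    exact mul_ne_zero (pow_ne_zero _ (by simp)) hcoeff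
  -- Invertibility of `A` turns `A σ(B) = B A` into a similarity between `B` and `σ(B)`.
  have hA : IsUnit A := by
    rw [Matrix.isUnit_iff_isUnit_det, isUnit_iff_ne_zero]
    intro h0
    rw [h0, Algebra.norm_zero, map_zero] at hdetB
    exact hBunit hdetB
  obtain ⟨U, hU⟩ := hA
  have hconj : A * B.map σ = B * A := by
    have h := semilinearPow_succ σ A n
    rw [pow_finrank_eq_one] at h
    exact h
  have hchar : B.charpoly.map (σ : L →+* L) = B.charpoly := by
    rw [← Matrix.charpoly_map, ← Matrix.charpoly_units_conj U, hU]
    congr 1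
    rw [show B.map (σ : L →+* L) = B.map σ from rfl, hconj, mul_assoc, ← hU, ← Matrix.coe_units_inv,
      U.mul_inv, mul_one]
  obtain ⟨χ, hχ⟩ : ∃ χ : K[X], χ.map (algebraMap K L) = B.charpoly := by
    rw [← mem_lifts, lifts_iff_coeff_lifts]
    intro i
    refine mem_range_algebraMap_of_apply_eq hσ ?_
    conv_rhs => rw [← hchar]
    rw [Polynomial.coeff_map]
    rfl
  have hχm : χ.Monic := by
    refine Polynomial.monic_of_injective (algebraMap K L).injective ?_
    rw [hχ]
    exact B.charpoly_monic
  have hχd : χ ∣ F ^ d := by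
    rw [← Polynomial.map_dvd_map (algebraMap K L) (algebraMap K L).injective hχm, hχ,
      Polynomial.map_pow]
    exact hdvd
  obtain ⟨j, -, hj⟩ := (dvd_prime_pow hFi.prime d).1 hχd
  have hχF : χ = F ^ j := eq_of_monic_of_associated hχm (hFm.pow j) hj
  refine ⟨j, ?_, ?_⟩
  · have h := B.charpoly_natDegree_eq_dim
    rw [← hχ, Polynomial.natDegree_map, hχF, hFm.natDegree_pow, Fintype.card_fin] at h
    rw [← h, mul_comm]
  · apply (algebraMap K L).injective
    rw [← hdetB, Matrix.det_eq_sign_charpoly_coeff, ← hχ, hχF, Polynomial.coeff_map,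
      Fintype.card_fin, Polynomial.coeff_zero_eq_eval_zero, Polynomial.eval_pow,
      ← Polynomial.coeff_zero_eq_eval_zero]
    simp

end Matrices

namespace SkewPoly

variable {K L : Type*} [Field K] [Field L] [Algebra K L] {σ : L ≃ₐ[K] L}

/-! ### Constant coefficients of divisors of `F(xⁿ)` -/

theorem leftQuot_smul_def {f : SkewPoly σ} (a : L) (v : LeftQuot f) : a • v = C σ a • v := by
  obtain ⟨p, rfl⟩ := cls_surjective f v
  rfl

theorem X_mul_C (a : L) : X σ * C σ a = C σ (σ a) * X σ := by
  simp [X, C, monomial_mul_monomial]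

theorem coeff_X_mul_succ (j : ℕ) (p : SkewPoly σ) : coeff (X σ * p) (j + 1) = σ (coeff p j) := by
  rw [add_comm, X, coeff_monomial_mul, one_mul, pow_one]

theorem X_smul_smul {f : SkewPoly σ} (a : L) (v : LeftQuot f) : X σ • a • v = σ a • X σ • v := by
  rw [leftQuot_smul_def, leftQuot_smul_def, ← mul_smul, ← mul_smul, X_mul_C]

theorem ofCoeffs_single {d : ℕ} (j : Fin d) (a : L) :
    ofCoeffs σ d (Pi.single j a) = monomial σ j a := by
  refine ext fun i => ?_
  by_cases hi : i < d
  · have h := coeff_ofCoeffs (σ := σ) (Pi.single j a) ⟨i, hi⟩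
    rw [coeff_monomial]
    refine h.trans ?_
    rw [Pi.single_apply]
    simp only [Fin.ext_iff, eq_comm]
  · rw [coeff_ofCoeffs_of_le _ (not_lt.1 hi), coeff_monomial, if_neg (by omega)]

/-- The companion matrix of a monic skew polynomial of degree `d`. -/
def companion (h : SkewPoly σ) (d : ℕ) : Matrix (Fin d) (Fin d) L :=
  Matrix.of fun i j => if (j : ℕ) + 1 < d then (if (i : ℕ) = j + 1 then 1 else 0) else -coeff h i

theorem det_companion {h : SkewPoly σ} {d : ℕ} (h1 : coeff h d = 1) :
    (companion h d).det = (-1) ^ d * coeff h 0 := by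
  cases d with
  | zero => simp [h1]
  | succ e =>
    rw [Matrix.det_succ_row_zero, Finset.sum_eq_single (Fin.last e)]
    · have hsub : (companion h (e + 1)).submatrix Fin.succ (Fin.last e).succAbove = 1 := by
        ext i j
        simp [companion, Matrix.one_apply, Fin.ext_iff]
      rw [hsub, Matrix.det_one]
      simp [companion, pow_succ]
    · intro j _ hj
      have : (j : ℕ) < e := by
        have := j.2
        have h2 : (j : ℕ) ≠ e := fun h2 => hj (Fin.ext h2)
        omega
      simp [companion, this]
    · simp

theorem X_smul_quotEquiv {h : SkewPoly σ} {d : ℕ} (hh : h.HasDegree d) (h1 : coeff h d = 1)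
    (v : Fin d → L) :
    X σ • quotEquiv hh v = quotEquiv hh ((companion h d).mulVec (σ ∘ v)) := by
  have hbasis : ∀ j : Fin d, X σ • quotEquiv hh (Pi.single j 1) =
      quotEquiv hh (fun i => companion h d i j) := by
    intro j
    rw [quotEquiv_apply, quotEquiv_apply, ofCoeffs_single, smul_cls]
    by_cases hj : (j : ℕ) + 1 < d
    · congr 1
      have : (fun i => companion h d i j) = Pi.single (⟨j + 1, hj⟩ : Fin d) 1 := by
        ext i
        simp [companion, hj, Pi.single_apply, Fin.ext_iff]
      rw [this, ofCoeffs_single, X, monomial_mul_monomial]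
      simp [add_comm]
    · have hjd : d = j + 1 := by omega
      refine (Submodule.Quotient.eq _).2 ?_
      -- In the last column, `x^d` minus its reduction is `h` itself.
      convert Ideal.mem_span_singleton_self h using 1
      have h2 : (fun i => companion h d i j) = fun i : Fin d => -coeff h i := by
        ext i
        simp [companion, hj]
      rw [h2]
      refine ext fun i => ?_
      rw [X, monomial_mul_monomial, map_one, mul_one, coeff_sub, coeff_monomial]
      by_cases hi : i < d
      · have h3 := coeff_ofCoeffs (σ := σ) (fun i : Fin d => -coeff h i) ⟨i, hi⟩
        simp only at h3
        rw [h3, if_neg (by omega)]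
        ring
      · rw [coeff_ofCoeffs_of_le _ (not_lt.1 hi), sub_zero]
        split_ifs with h4
        · rw [show i = d by omega, h1]
        · exact (hh.2 i (by omega)).symm
  have hv : v = ∑ j, v j • (Pi.single j 1 : Fin d → L) := by
    ext i
    simp [Finset.sum_apply, Pi.single_apply]
  conv_lhs => rw [hv]
  rw [map_sum, Finset.smul_sum, Matrix.mulVec_eq_sum, map_sum]
  refine Finset.sum_congr rfl fun j _ => ?_
  rw [map_smul, X_smul_smul, hbasis, ← map_smul]
  congr 1
  ext i
  simp [mul_comm]

theorem X_pow_smul_quotEquiv {h : SkewPoly σ} {d : ℕ} (hh : h.HasDegree d) (h1 : coeff h d = 1)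
    (k : ℕ) (v : Fin d → L) :
    X σ ^ k • quotEquiv hh v =
      quotEquiv hh ((semilinearPow σ (companion h d) k).mulVec ((σ ^ k : L ≃ₐ[K] L) ∘ v)) := by
  induction k with
  | zero =>
    simp only [pow_zero, one_smul, semilinearPow, Matrix.one_mulVec]
    rfl
  | succ k ih =>
    rw [pow_succ', mul_smul, ih, X_smul_quotEquiv hh h1, semilinearPow, ← Matrix.mulVec_mulVec]
    congr 2
    ext i
    simp only [Function.comp_apply, pow_succ']
    exact RingHom.map_mulVec (σ : L →+* L) _ _ i

/-- Exhibits `F ↦ F(xⁿ)` as a ring homomorphism, which carries products and Bézout identities from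
`K[y]` to `R`. -/
theorem centralPoly_eq_aeval (F : K[X]) :
    centralPoly σ F = aeval (X σ ^ Module.finrank K L) F := by
  rw [centralPoly, aeval_def, eval₂_eq_sum]
  congr 1
  ext i c : 2
  rw [← pow_mul, X_pow, algebraMap_def, C_mul_monomial, mul_one]

theorem centralPoly_mul (F G : K[X]) :
    centralPoly σ (F * G) = centralPoly σ F * centralPoly σ G := by
  simp only [centralPoly_eq_aeval, map_mul]

theorem coeff_centralPoly [FiniteDimensional K L] (F : K[X]) (i : ℕ) :
    coeff (centralPoly σ F) i = if Module.finrank K L ∣ i then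
      algebraMap K L (F.coeff (i / Module.finrank K L)) else 0 := by
  have hn : 0 < Module.finrank K L := Module.finrank_pos
  rw [centralPoly, Polynomial.sum_def, coeff_sum]
  simp only [coeff_monomial]
  split_ifs with h
  · obtain ⟨j, rfl⟩ := h
    rw [Nat.mul_div_cancel_left _ hn, Finset.sum_eq_single j]
    · simp
    · intro b _ hb
      rw [if_neg]
      exact fun h => hb (Nat.eq_of_mul_eq_mul_left hn h)
    · intro hj
      simp [Polynomial.notMem_support_iff.1 hj]
  · refine Finset.sum_eq_zero fun j _ => if_neg ?_
    rintro rfl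
    exact h (dvd_mul_right _ _)

theorem hasDegree_centralPoly [FiniteDimensional K L] {F : K[X]} (hF : F ≠ 0) :
    (centralPoly σ F).HasDegree (F.natDegree * Module.finrank K L) := by
  have hn : 0 < Module.finrank K L := Module.finrank_pos
  refine ⟨?_, fun i hi => ?_⟩
  · rw [coeff_centralPoly, if_pos (dvd_mul_left _ _), Nat.mul_div_cancel _ hn]
    simpa using hF
  · rw [coeff_centralPoly]
    split_ifs with h
    · obtain ⟨j, rfl⟩ := h
      rw [Nat.mul_div_cancel_left _ hn, Polynomial.coeff_eq_zero_of_natDegree_lt, map_zero]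
      rw [mul_comm] at hi
      exact lt_of_mul_lt_mul_left hi (Nat.zero_le _)
    · rfl

/-! ### The simple module `R / R f` -/

/-- Left ideals are principal, so one strictly above `R f` is `R g` with `f = q g`, and
irreducibility makes `g` a unit. -/
theorem isSimpleModule_leftQuot {f : SkewPoly σ} (hf : Irreducible f) :
    IsSimpleModule (SkewPoly σ) (LeftQuot f) := by
  rw [isSimpleModule_iff_isCoatom]
  refine ⟨fun htop => hf.not_isUnit ?_, fun J hJ => ?_⟩
  · have h1 : (1 : SkewPoly σ) ∈ Ideal.span {f} := by rw [htop]; trivial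
    obtain ⟨q, hq⟩ := Ideal.mem_span_singleton'.1 h1
    -- A one-sided inverse is two-sided because `R` has no zero divisors.
    have h2 : f * q = 1 := by
      have h3 : (f * q - 1) * f = 0 := by
        rw [sub_mul, mul_assoc, hq, mul_one, one_mul, sub_self]
      exact sub_eq_zero.1 ((mul_eq_zero.1 h3).resolve_right hf.ne_zero)
    exact ⟨⟨f, q, h2, hq⟩, rfl⟩
  · obtain ⟨g, d, -, -, rfl⟩ := exists_monic_span_eq J (ne_bot_of_gt hJ)
    obtain ⟨q, hq⟩ := Ideal.mem_span_singleton'.1 (hJ.le (Ideal.mem_span_singleton_self f))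
    rcases hf.isUnit_or_isUnit hq.symm with h | h
    · refine absurd ?_ hJ.not_ge
      rw [← hq, Ideal.span_singleton_mul_left_unit h]
    · have h1 := Ideal.span_singleton_mul_left_unit h 1
      rw [mul_one] at h1
      rw [h1, Ideal.span_singleton_one]

variable [FiniteDimensional K L] [IsGalois K L]

theorem centralPoly_smul_quotEquiv {h : SkewPoly σ} {d : ℕ} (hh : h.HasDegree d)
    (h1 : coeff h d = 1) (F : K[X]) (v : Fin d → L) :
    centralPoly σ F • quotEquiv hh v = quotEquiv hh
      ((aeval (semilinearPow σ (companion h d) (Module.finrank K L)) F).mulVec v) := by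
  rw [centralPoly_eq_aeval]
  have hX : ∀ v, X σ ^ Module.finrank K L • quotEquiv hh v = quotEquiv hh
      ((semilinearPow σ (companion h d) (Module.finrank K L)).mulVec v) := by
    intro v
    rw [X_pow_smul_quotEquiv hh h1, pow_finrank_eq_one]
    rfl
  induction F using Polynomial.induction_on generalizing v with
  | C a =>
    rw [aeval_C, aeval_C, algebraMap_def, ← leftQuot_smul_def, ← map_smul]
    congr 1
    ext i
    rw [Matrix.algebraMap_eq_diagonal, Matrix.mulVec_diagonal]
    simp
  | add p q hp hq =>
    rw [map_add, add_smul, hp, hq, map_add, Matrix.add_mulVec, map_add]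
  | monomial i a ih =>
    rw [pow_succ, ← mul_assoc, map_mul, mul_smul, aeval_X, hX, ih, Matrix.mulVec_mulVec,
      map_mul (aeval (semilinearPow σ (companion h d) (Module.finrank K L)))
        (Polynomial.C a * Polynomial.X ^ i), aeval_X]

theorem centralPoly_smul_eq_zero {F : K[X]} {f : SkewPoly σ}
    (hfF : ∃ g, g * f = centralPoly σ F) (v : LeftQuot f) : centralPoly σ F • v = 0 := by
  obtain ⟨p, rfl⟩ := cls_surjective f v
  obtain ⟨g, hg⟩ := hfF
  rw [smul_cls, cls_eq_zero, centralPoly_comm, ← hg, ← mul_assoc]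
  exact Ideal.mem_span_singleton'.2 ⟨_, rfl⟩

/-- The degree and the norm of the constant coefficient of a monic right divisor of `F(xⁿ)`. -/
theorem norm_coeff_zero_of_dvd (hσ : Subgroup.zpowers σ = ⊤) {F : K[X]} (hFm : F.Monic)
    (hFi : Irreducible F) (hF0 : F.coeff 0 ≠ 0) {h : SkewPoly σ} {d : ℕ} (hh : h.HasDegree d)
    (h1 : coeff h d = 1) (hdvd : ∃ g, g * h = centralPoly σ F) :
    ∃ j, d = F.natDegree * j ∧ Algebra.norm K (coeff h 0) =
      (-1) ^ (d * (Module.finrank K L - 1)) * F.coeff 0 ^ j := by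
  -- `F(xⁿ)` kills `R / R h`, so the matrix of `xⁿ` is a root of `F`.
  obtain ⟨j, hj, hnorm⟩ := semilinearPow_charpoly hσ (companion h d) F hFm hFi hF0 (by
    refine Matrix.mulVec_injective (funext fun v => (quotEquiv hh).injective ?_)
    rw [← centralPoly_smul_quotEquiv hh h1, centralPoly_smul_eq_zero hdvd, Matrix.zero_mulVec,
      map_zero])
  refine ⟨j, hj, ?_⟩
  obtain ⟨e, he⟩ : ∃ e, Module.finrank K L = e + 1 :=
    Nat.exists_eq_succ_of_ne_zero Module.finrank_pos.ne'
  -- The companion determinant is `(-1)^d h₀`, whose norm carries the sign `(-1)^(dn)`. Together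
  -- with the `(-1)^d` from the characteristic polynomial this leaves `(-1)^(d(n-1))`.
  have hneg : Algebra.norm K ((-1 : L) ^ d) = (-1) ^ (d * (e + 1)) := by
    have h2 := Algebra.norm_algebraMap (S := L) ((-1 : K) ^ d)
    rw [map_pow, map_neg, map_one, he, ← pow_mul] at h2
    exact h2
  rw [det_companion h1, map_mul, hneg] at hnorm
  rw [he, Nat.add_sub_cancel]
  have hsq : ∀ k : ℕ, ((-1 : K) ^ k) * (-1) ^ k = 1 := fun k => by
    rw [← mul_pow]; simp
  calc Algebra.norm K (coeff h 0)
      = (-1) ^ (d * (e + 1)) * ((-1) ^ (d * (e + 1)) * Algebra.norm K (coeff h 0)) := by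
        rw [← mul_assoc, hsq, one_mul]
    _ = (-1) ^ (d * e) * F.coeff 0 ^ j := by
        rw [hnorm, ← mul_assoc, mul_add, mul_one, pow_add, mul_assoc ((-1) ^ (d * e)), hsq, mul_one]

/-- The annihilator of `R / R f` is `R F(xⁿ)`. -/
theorem mem_span_centralPoly_of_smul_eq_zero (hσ : Subgroup.zpowers σ = ⊤) {F : K[X]}
    (hFi : Irreducible F) (hF0 : F.coeff 0 ≠ 0) {f : SkewPoly σ} (hf : Irreducible f)
    (hfF : ∃ g, g * f = centralPoly σ F) {a : SkewPoly σ} (ha : ∀ v : LeftQuot f, a • v = 0) :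
    a ∈ Ideal.span {centralPoly σ F} := by
  have hn : 0 < Module.finrank K L := Module.finrank_pos
  set J : Ideal (SkewPoly σ) := Module.annihilator (SkewPoly σ) (LeftQuot f) with hJdef
  have hJF : centralPoly σ F ∈ J := Module.mem_annihilator.2 (centralPoly_smul_eq_zero hfF)
  have hJ0 : J ≠ ⊥ := fun h0 => (hasDegree_centralPoly (σ := σ) hFi.ne_zero).ne_zero (by
    rwa [h0] at hJF)
  have hJ1 : (1 : SkewPoly σ) ∉ J := fun h1 => by
    have := (isSimpleModule_leftQuot hf).nontrivial
    obtain ⟨v, hv⟩ := exists_ne (0 : LeftQuot f)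
    exact hv (by simpa using Module.mem_annihilator.1 h1 v)
  -- `J` is two-sided. Its monic generator `g` will be shown to have the form `G(xⁿ)`, by commuting
  -- `g` with constants and with `x`.
  have hJr : ∀ p q, p ∈ J → p * q ∈ J := fun p q hp => Module.mem_annihilator.2 fun v => by
    rw [mul_smul]
    exact Module.mem_annihilator.1 hp _
  obtain ⟨g, d, hg, hg1, hJg⟩ := exists_monic_span_eq J hJ0
  have hgJ : g ∈ J := by
    rw [hJg]
    exact Ideal.mem_span_singleton_self g
  have hsmall : ∀ r ∈ J, (∀ i, d ≤ i → coeff r i = 0) → r = 0 := fun r hr hr0 =>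
    eq_zero_of_mem_span hg hr0 (hJg ▸ hr)
  -- `g` right-divides `F(xⁿ)`, whose constant coefficient is `F₀ ≠ 0`.
  have hg0 : coeff g 0 ≠ 0 := by
    rw [hJg] at hJF
    obtain ⟨q, hq⟩ := Ideal.mem_span_singleton'.1 hJF
    have h1 := congrArg (fun p => coeff p 0) hq
    simp only [coeff_mul_zero, coeff_centralPoly, dvd_zero, if_true, Nat.zero_div] at h1
    intro h0
    rw [h0, mul_zero] at h1
    exact hF0 ((_root_.map_eq_zero _).1 h1.symm)
  -- `g b - σ^d(b) g` lies in `J` and has degree below `d`, so it vanishes.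
  have hcomm : ∀ (b : L) (i : ℕ), coeff g i * (σ ^ i) b = (σ ^ d) b * coeff g i := by
    intro b i
    have h0 : g * C σ b - C σ ((σ ^ d) b) * g = 0 := by
      refine hsmall _ (J.sub_mem (hJr _ _ hgJ) (J.mul_mem_left _ hgJ)) fun i hi => ?_
      rw [coeff_sub, coeff_mul_C, coeff_C_mul]
      rcases eq_or_lt_of_le hi with rfl | hi
      · rw [mul_comm, sub_self]
      · rw [hg.2 i hi, zero_mul, mul_zero, sub_zero]
    have h1 := congrArg (fun p => coeff p i) h0
    simp only [coeff_sub, coeff_mul_C, coeff_C_mul, coeff_zero] at h1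
    exact sub_eq_zero.1 h1
  -- `g x - x g` has degree at most `d`, so it equals `c g` for a constant `c`. Its constant
  -- coefficient is `0` while `g₀ ≠ 0`, hence `c = 0`.
  have hfix : ∀ i, σ (coeff g i) = coeff g i := by
    set r := g * X σ - X σ * g with hr
    have hrJ : r ∈ J := J.sub_mem (hJr _ _ hgJ) (J.mul_mem_left _ hgJ)
    have hrd : ∀ i, d < i → coeff r i = 0 := by
      intro i hi
      obtain ⟨j, rfl⟩ := Nat.exists_eq_succ_of_ne_zero (show i ≠ 0 by omega)
      rw [Nat.succ_eq_add_one, hr, coeff_sub, coeff_mul_X_succ, coeff_X_mul_succ]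
      rcases eq_or_lt_of_le (show d ≤ j by omega) with rfl | hj
      · rw [hg1, map_one, sub_self]
      · rw [hg.2 j hj, map_zero, sub_self]
    have h0 : r - C σ (coeff r d) * g = 0 := by
      refine hsmall _ (J.sub_mem hrJ (J.mul_mem_left _ hgJ)) fun i hi => ?_
      rw [coeff_sub, coeff_C_mul]
      rcases eq_or_lt_of_le hi with rfl | hi
      · rw [hg1, mul_one, sub_self]
      · rw [hg.2 i hi, hrd i hi, mul_zero, sub_zero]
    have h1 := congrArg (fun p => coeff p 0) h0
    simp only [coeff_sub, coeff_C_mul, coeff_zero] at h1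
    rw [hr, coeff_sub, coeff_mul_X_zero, X, coeff_mul_zero, coeff_monomial, ← X, ← hr] at h1
    have hc : coeff r d = 0 := by simpa [hg0] using h1
    intro i
    have hr0 : r = 0 := by rw [sub_eq_zero.1 h0, hc, C, monomial_zero, zero_mul]
    have h2 := congrArg (fun p => coeff p (i + 1)) hr0
    simp only [hr, coeff_sub, coeff_mul_X_succ, coeff_X_mul_succ, coeff_zero] at h2
    exact (sub_eq_zero.1 h2).symm
  -- The coefficient `g₀ ≠ 0` gives `σ^d = 1`; then `gᵢ ≠ 0` gives `σ^i = 1`, that is `n ∣ i`.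
  have hdvd : ∀ i, coeff g i ≠ 0 → Module.finrank K L ∣ i := by
    have hd : σ ^ d = 1 := AlgEquiv.ext fun b => by
      have h := hcomm b 0
      rw [pow_zero, mul_comm] at h
      exact (mul_right_cancel₀ hg0 h).symm
    intro i hi
    rw [← orderOf_eq_finrank hσ, orderOf_dvd_iff_pow_eq_one]
    refine AlgEquiv.ext fun b => ?_
    have h := hcomm b i
    rw [hd, mul_comm] at h
    exact mul_right_cancel₀ hi h
  choose c hc using fun i => mem_range_algebraMap_of_apply_eq hσ (hfix i)
  obtain ⟨G, hG⟩ : ∃ G : K[X], centralPoly σ G = g := by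
    refine ⟨∑ j ∈ Finset.range (d + 1), Polynomial.monomial j (c (Module.finrank K L * j)),
      ext fun i => ?_⟩
    rw [coeff_centralPoly]
    split_ifs with hi
    · obtain ⟨j, rfl⟩ := hi
      rw [Nat.mul_div_cancel_left _ hn, Polynomial.finsetSum_coeff]
      simp only [Polynomial.coeff_monomial, Finset.sum_ite_eq', Finset.mem_range]
      split_ifs with hj
      · exact hc _
      · rw [map_zero, hg.2]
        nlinarith
    · by_contra hne
      exact hi (hdvd i (Ne.symm hne))
  -- Otherwise `F` and `G` are coprime, and Bézout puts `1` in the annihilator `J`.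
  have hFG : F ∣ G := by
    by_contra hnd
    obtain ⟨u, v, huv⟩ := (EuclideanDomain.dvd_or_coprime F G hFi).resolve_left hnd
    have h1 := congrArg (centralPoly σ) huv
    simp only [centralPoly_eq_aeval, map_add, map_mul, map_one] at h1
    simp only [← centralPoly_eq_aeval, hG] at h1
    exact hJ1 (h1 ▸ J.add_mem (J.mul_mem_left _ hJF) (J.mul_mem_left _ hgJ))
  obtain ⟨Q, rfl⟩ := hFG
  have haJ : a ∈ J := Module.mem_annihilator.2 ha
  rw [hJg] at haJ
  obtain ⟨q, rfl⟩ := Ideal.mem_span_singleton'.1 haJ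
  rw [← hG, mul_comm F, centralPoly_mul, ← mul_assoc]
  exact Ideal.mem_span_singleton'.2 ⟨_, rfl⟩

end SkewPoly

/-! ### Linear algebra over a ring all of whose nonzero elements are units -/

section DivisionRings

variable {D V : Type*} [Ring D] [Nontrivial D] [AddCommGroup V] [Module D V]
  (hD : ∀ a : D, IsUnit a ∨ a = 0)

include hD

/-- The division ring structure is built inside the proof over the given ring structure, so the
result applies to `(Eigenring f)ᵐᵒᵖ` as it stands. -/
theorem exists_linearMap_apply_eq {W : Type*} [AddCommGroup W] [Module D W] {ι : Type*}
    {v : ι → V} (hv : LinearIndependent D v) (w : ι → W) : ∃ φ : V →ₗ[D] W, ∀ i, φ (v i) = w i := by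
  let _ := DivisionRing.ofIsUnitOrEqZero hD
  obtain ⟨g, hg⟩ := LinearMap.exists_leftInverse_of_injective
    (Finsupp.linearCombination D v) (LinearMap.ker_eq_bot.2 hv)
  refine ⟨(Finsupp.linearCombination D w).comp g, fun i => ?_⟩
  have h1 := LinearMap.congr_fun hg (Finsupp.single i 1)
  simp only [LinearMap.comp_apply, Finsupp.linearCombination_single, one_smul,
    LinearMap.id_apply] at h1
  simp [h1]

variable [Module.Finite D V]

theorem exists_basis_fin_of_isUnit_or_eq_zero : ∃ t, Nonempty (Module.Basis (Fin t) D V) := by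
  let _ := DivisionRing.ofIsUnitOrEqZero hD
  exact ⟨_, ⟨Module.finBasis D V⟩⟩

theorem exists_linearIndependent_apply_eq_zero {t k : ℕ} (B : Module.Basis (Fin t) D V)
    (φ : V →ₗ[D] V) (h : Module.finrank D (LinearMap.range φ) + k ≤ t) :
    ∃ v : Fin k → V, LinearIndependent D v ∧ ∀ i, φ (v i) = 0 := by
  let _ := DivisionRing.ofIsUnitOrEqZero hD
  have h1 := φ.finrank_range_add_finrank_ker
  rw [Module.finrank_eq_card_basis B, Fintype.card_fin] at h1
  obtain ⟨v, hv⟩ := exists_linearIndependent_of_le_finrank (R := D) (M := LinearMap.ker φ) (n := k)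
    (by omega)
  exact ⟨fun i => v i, hv.map' (LinearMap.ker φ).subtype (Submodule.ker_subtype _),
    fun i => (v i).2⟩

theorem finrank_range_add_le {t k : ℕ} (B : Module.Basis (Fin t) D V)
    (φ : V →ₗ[D] V) {v : Fin k → V} (hv : LinearIndependent D v) (h : ∀ i, φ (v i) = 0) :
    Module.finrank D (LinearMap.range φ) + k ≤ t := by
  let _ := DivisionRing.ofIsUnitOrEqZero hD
  have h1 := φ.finrank_range_add_finrank_ker
  rw [Module.finrank_eq_card_basis B, Fintype.card_fin] at h1
  let w : Fin k → LinearMap.ker φ := fun i => ⟨v i, h i⟩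
  have hw : LinearIndependent D w := LinearIndependent.of_comp (LinearMap.ker φ).subtype hv
  have h2 := hw.fintype_card_le_finrank
  rw [Fintype.card_fin] at h2
  omega

end DivisionRings

namespace SkewPoly

variable {K L : Type*} [Field K] [Field L] [Algebra K L] {σ : L ≃ₐ[K] L}

/-! ### The eigenring -/

section EigenringLemmas

variable (f : SkewPoly σ)

scoped instance : Ring (Eigenring f) := Ideal.Quotient.ring _
scoped instance : Semiring (Eigenring f) := Ring.toSemiring
scoped instance : MonoidWithZero (Eigenring f) := Semiring.toMonoidWithZero
scoped instance : Monoid (Eigenring f) := MonoidWithZero.toMonoid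
scoped instance : AddCommGroup (Eigenring f) := Ring.toAddCommGroup
scoped instance : AddCommMonoid (Eigenring f) := AddCommGroup.toAddCommMonoid
scoped instance : Algebra K (Eigenring f) := Ideal.Quotient.algebra K
scoped instance (k : Subfield K) : Algebra k (Eigenring f) := inferInstance
scoped instance (k : Subfield K) : Module k (Eigenring f) := Algebra.toModule
scoped instance : Ring (Eigenring f)ᵐᵒᵖ := MulOpposite.instRing
scoped instance : Semiring (Eigenring f)ᵐᵒᵖ := Ring.toSemiring
scoped instance : MonoidWithZero (Eigenring f)ᵐᵒᵖ := Semiring.toMonoidWithZero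
scoped instance : Monoid (Eigenring f)ᵐᵒᵖ := MonoidWithZero.toMonoid
scoped instance : DistribMulAction (Eigenring f)ᵐᵒᵖ (LeftQuot f) := Module.toDistribMulAction
scoped instance : MulAction (Eigenring f)ᵐᵒᵖ (LeftQuot f) := DistribMulAction.toMulAction
scoped instance : SMul (Eigenring f)ᵐᵒᵖ (LeftQuot f) := (instRightModule f).toSMul

theorem eigenring_mk_surjective (α : Eigenring f) :
    ∃ g : idealizer f, Ideal.Quotient.mk (eigenIdeal f) g = α :=
  Ideal.Quotient.mk_surjective α

instance : SMulCommClass (SkewPoly σ) (Eigenring f)ᵐᵒᵖ (LeftQuot f) where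
  smul_comm p α v := by
    induction α using MulOpposite.rec' with | _ α => ?_
    obtain ⟨g, rfl⟩ := eigenring_mk_surjective f α
    obtain ⟨q, rfl⟩ := cls_surjective f v
    rw [op_smul_cls, smul_cls, smul_cls, op_smul_cls, mul_assoc]

instance : IsScalarTower K (Eigenring f)ᵐᵒᵖ (LeftQuot f) where
  smul_assoc c α v := by
    induction α using MulOpposite.rec' with | _ α => ?_
    obtain ⟨g, rfl⟩ := eigenring_mk_surjective f α
    obtain ⟨q, rfl⟩ := cls_surjective f v
    show cls f (q * (c • g : SkewPoly σ)) = cls f (c • (q * g))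
    rw [mul_smul_comm]

instance (k : Subfield K) : IsScalarTower k (Eigenring f)ᵐᵒᵖ (LeftQuot f) where
  smul_assoc c α v := smul_assoc (c : K) α v

variable {f}

/-- If `1 · g` lies in `R f`, then `g` is zero in `E(f)`. Identities in the eigenring can thus be
tested on the class of `1`, and `E(f)` embeds in `R / R f`. -/
theorem op_smul_cls_one_injective :
    Function.Injective fun α : Eigenring f => op α • cls f 1 := by
  intro α β h
  rw [← sub_eq_zero]
  have h0 : op (α - β) • cls f 1 = 0 := by
    rw [op_sub, sub_smul]
    exact sub_eq_zero.2 h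
  obtain ⟨g, hg⟩ := eigenring_mk_surjective f (α - β)
  rw [← hg, op_smul_cls, one_mul, cls_eq_zero] at h0
  rw [← hg]
  exact Ideal.Quotient.eq_zero_iff_mem.2 h0

/-- An endomorphism is determined by the image `g` of the class of `1`; as `f` kills that class, `f
g ∈ R f`. -/
theorem exists_eigenring_smul_eq (φ : Module.End (SkewPoly σ) (LeftQuot f)) :
    ∃ α : Eigenring f, ∀ v, φ v = op α • v := by
  obtain ⟨g, hg⟩ := cls_surjective f (φ (cls f 1))
  have hφ : ∀ q, φ (cls f q) = cls f (q * g) := by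
    intro q
    rw [← smul_cls, hg, ← map_smul, smul_cls, mul_one]
  have hmem : f * g ∈ Ideal.span {f} := by
    rw [← cls_eq_zero, ← hφ, cls_eq_zero.2 (Ideal.mem_span_singleton_self f), map_zero]
  refine ⟨Ideal.Quotient.mk (eigenIdeal f) ⟨g, hmem⟩, fun v => ?_⟩
  obtain ⟨q, rfl⟩ := cls_surjective f v
  rw [hφ, op_smul_cls]

variable (hf : Irreducible f)

include hf

theorem nontrivial_leftQuot : Nontrivial (LeftQuot f) := (isSimpleModule_leftQuot hf).nontrivial

theorem cls_one_ne_zero : cls f 1 ≠ 0 := by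
  intro h0
  have := nontrivial_leftQuot hf
  obtain ⟨v, hv⟩ := exists_ne (0 : LeftQuot f)
  obtain ⟨p, rfl⟩ := cls_surjective f v
  apply hv
  rw [← mul_one p, ← smul_cls, h0, smul_zero]

theorem nontrivial_eigenring : Nontrivial (Eigenring f) := by
  refine ⟨1, 0, fun h => cls_one_ne_zero hf ?_⟩
  rw [← one_smul (Eigenring f)ᵐᵒᵖ (cls f 1), ← op_one, h, op_zero, zero_smul]

/-- Schur's lemma: right multiplication by `α ≠ 0` is bijective on a simple module, and its inverse
again comes from the eigenring. -/
theorem isUnit_eigenring {α : Eigenring f} (hα : α ≠ 0) : IsUnit α := by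
  have := isSimpleModule_leftQuot hf
  let φ : Module.End (SkewPoly σ) (LeftQuot f) :=
    { toFun := fun v => op α • v
      map_add' := smul_add _
      map_smul' := fun p v => (smul_comm p (op α) v).symm }
  have hφ : Function.Bijective φ := by
    refine φ.bijective_or_eq_zero.resolve_right fun h0 => hα ?_
    apply op_smul_cls_one_injective
    show op α • cls f 1 = op 0 • cls f 1
    rw [op_zero, zero_smul]
    exact LinearMap.congr_fun h0 (cls f 1)
  let e := LinearEquiv.ofBijective φ hφ
  obtain ⟨β, hβ⟩ := exists_eigenring_smul_eq (e.symm : Module.End (SkewPoly σ) (LeftQuot f))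
  have h1 : ∀ v, op α • op β • v = v := fun v => by
    rw [← hβ v]
    exact e.apply_symm_apply v
  have h2 : ∀ v, op β • op α • v = v := fun v => by
    rw [← hβ (op α • v)]
    exact e.symm_apply_apply v
  refine ⟨⟨α, β, ?_, ?_⟩, rfl⟩
  · apply op_smul_cls_one_injective
    simp only [op_mul, mul_smul, h2, op_one, one_smul]
  · apply op_smul_cls_one_injective
    simp only [op_mul, mul_smul, h1, op_one, one_smul]

theorem isUnit_or_eq_zero_eigenring_op (α : (Eigenring f)ᵐᵒᵖ) : IsUnit α ∨ α = 0 := by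
  by_cases h : unop α = 0
  · exact Or.inr (unop_injective h)
  · exact Or.inl (isUnit_eigenring hf h).op

theorem nontrivial_eigenring_op : Nontrivial (Eigenring f)ᵐᵒᵖ :=
  have := nontrivial_eigenring hf
  MulOpposite.instNontrivial

/-- Density: some `E(f)`-linear map sends `v` to `w`. It commutes with all `R`-endomorphisms, since
these come from `E(f)`, so Jacobson's theorem realises it on finitely many vectors by an element of
`R`. -/
theorem exists_smul_eq_of_linearIndependent {k : ℕ} {v : Fin k → LeftQuot f}
    (hv : LinearIndependent (Eigenring f)ᵐᵒᵖ v) (w : Fin k → LeftQuot f) :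
    ∃ p : SkewPoly σ, ∀ i, p • v i = w i := by
  classical
  have := isSimpleModule_leftQuot hf
  have := nontrivial_eigenring_op hf
  obtain ⟨g, hg⟩ := exists_linearMap_apply_eq (isUnit_or_eq_zero_eigenring_op hf) hv w
  let φ : Module.End (Module.End (SkewPoly σ) (LeftQuot f)) (LeftQuot f) :=
    { toFun := g
      map_add' := map_add g
      map_smul' := fun ψ u => by
        obtain ⟨α, hα⟩ := exists_eigenring_smul_eq ψ
        simp only [Module.End.smul_def, RingHom.id_apply, hα, map_smul] }
  obtain ⟨p, hp⟩ := jacobson_density φ (Finset.univ.image v)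
  refine ⟨p, fun i => ?_⟩
  rw [← hp (v i) (Finset.mem_image_of_mem _ (Finset.mem_univ i))]
  exact hg i

end EigenringLemmas

/-! ### Lengths -/

/-- Right multiplication by `p` gives the exact sequence `0 → R/Rq → R/Rqp → R/Rp → 0`. -/
theorem length_leftQuot_mul {p q : SkewPoly σ} (hp : p ≠ 0) :
    Module.length (SkewPoly σ) (LeftQuot (q * p)) =
      Module.length (SkewPoly σ) (LeftQuot q) + Module.length (SkewPoly σ) (LeftQuot p) := by
  have hle : Ideal.span {q * p} ≤ Ideal.span {p} :=
    (Ideal.span_singleton_le_iff_mem _).2 (Ideal.mem_span_singleton'.2 ⟨q, rfl⟩)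
  have hcomap : ∀ r, r * p ∈ Ideal.span {q * p} ↔ r ∈ Ideal.span {q} := by
    intro r
    rw [Ideal.mem_span_singleton', Ideal.mem_span_singleton']
    refine exists_congr fun c => ?_
    rw [← mul_assoc]
    exact mul_left_inj' hp
  let i : LeftQuot q →ₗ[SkewPoly σ] LeftQuot (q * p) :=
    Submodule.mapQ _ _ (LinearMap.toSpanSingleton (SkewPoly σ) (SkewPoly σ) p) fun r hr =>
      (hcomap r).2 hr
  let π : LeftQuot (q * p) →ₗ[SkewPoly σ] LeftQuot p := Submodule.factor hle
  refine Module.length_eq_add_of_exact i π ?_ (Submodule.factor_surjective hle) ?_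
  · refine (injective_iff_map_eq_zero i).2 fun v hv => ?_
    obtain ⟨r, rfl⟩ := cls_surjective q v
    exact cls_eq_zero.2 ((hcomap r).1 (cls_eq_zero.1 hv))
  · intro v
    obtain ⟨r, rfl⟩ := cls_surjective _ v
    constructor
    · intro h
      obtain ⟨c, rfl⟩ := Ideal.mem_span_singleton'.1 (cls_eq_zero.1 (show cls p r = 0 from h))
      exact ⟨cls q c, rfl⟩
    · rintro ⟨w, hw⟩
      obtain ⟨c, rfl⟩ := cls_surjective q w
      rw [← hw]
      exact cls_eq_zero.2 (Ideal.mem_span_singleton'.2 ⟨c, rfl⟩)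

theorem length_leftQuot_of_isProduct {p : SkewPoly σ} {m : ℕ} (hp : IsProductOfIrreducibles p m) :
    Module.length (SkewPoly σ) (LeftQuot p) = m := by
  obtain ⟨l, rfl, hl, rfl⟩ := hp
  induction l with
  | nil =>
    rw [List.prod_nil, List.length_nil, Nat.cast_zero, Module.length_eq_zero_iff]
    exact Submodule.Quotient.subsingleton_iff.2 Ideal.span_singleton_one
  | cons q l ih =>
    have hl0 : l.prod ≠ 0 := List.prod_ne_zero fun h =>
      (hl 0 (List.mem_cons_of_mem _ h)).ne_zero rfl
    have := isSimpleModule_leftQuot (hl q List.mem_cons_self)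
    rw [List.prod_cons, length_leftQuot_mul hl0, ih fun r hr => hl r (List.mem_cons_of_mem _ hr),
      Module.length_eq_one, List.length_cons, Nat.cast_succ, add_comm]

end SkewPoly

namespace SkewPoly

variable {K L : Type*} [Field K] [Field L] [Algebra K L] {σ : L ≃ₐ[K] L}

/-! ### Left multiplications on `R / R f` -/

variable {f : SkewPoly σ}

/-- Left multiplication on `R / R f` as an `E(f)`-linear map. -/
def leftMul (f p : SkewPoly σ) : LeftQuot f →ₗ[(Eigenring f)ᵐᵒᵖ] LeftQuot f where
  toFun v := p • v
  map_add' := smul_add p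
  map_smul' α v := smul_comm p α v

theorem leftMul_apply (p : SkewPoly σ) (v : LeftQuot f) : leftMul f p v = p • v := rfl

variable {t : ℕ} (B : Module.Basis (Fin t) (Eigenring f)ᵐᵒᵖ (LeftQuot f))

/-- Coordinates with respect to a right `E(f)`-basis of `R / R f`. -/
def coords : LeftQuot f ≃ₗ[(Eigenring f)ᵐᵒᵖ] (Fin t → Eigenring f) where
  toFun v i := unop (B.equivFun v i)
  invFun w := B.equivFun.symm fun i => op (w i)
  map_add' v w := by
    ext i
    simp only [map_add, Pi.add_apply, unop_add]
  map_smul' α v := by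
    ext i
    simp only [map_smul, Pi.smul_apply, smul_eq_mul, unop_mul, RingHom.id_apply,
      MulOpposite.smul_eq_mul_unop]
  left_inv v := by simp only [op_unop, LinearEquiv.symm_apply_apply]
  right_inv w := by
    ext i
    simp only [LinearEquiv.apply_symm_apply, unop_op]

theorem sum_coords (v : LeftQuot f) : ∑ i, op (coords B v i) • B i = v := by
  simpa only [coords, LinearEquiv.coe_mk, op_unop] using! B.sum_equivFun v

theorem coords_sum (w : Fin t → Eigenring f) : coords B (∑ i, op (w i) • B i) = w := by
  have h := (coords B).apply_symm_apply w
  rwa [show (coords B).symm w = ∑ i, op (w i) • B i from B.equivFun_symm_apply _] at h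

theorem coords_smul (c : K) (v : LeftQuot f) : coords B (c • v) = c • coords B v := by
  have h : c • v = op (algebraMap K (Eigenring f) c) • v := by
    conv_lhs => rw [← one_smul (Eigenring f)ᵐᵒᵖ v, ← smul_assoc]
    congr 1
    rw [Algebra.algebraMap_eq_smul_one]
    rfl
  rw [h, map_smul]
  ext i
  rw [Pi.smul_apply, Pi.smul_apply, op_smul_eq_mul, Algebra.smul_def, Algebra.commutes]

/-- The coordinates as a linear map over a subfield of `K`. -/
def coordsSubfield (k : Subfield K) : LeftQuot f ≃ₗ[k] (Fin t → Eigenring f) :=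
  { coords B with map_smul' := fun c v => coords_smul B (c : K) v }

/-- The matrix of a left multiplication on `R / R f`. -/
def leftMatrix (p : SkewPoly σ) : Matrix (Fin t) (Fin t) (Eigenring f) :=
  Matrix.of fun i j => coords B (p • B j) i

theorem smul_basis (p : SkewPoly σ) (j : Fin t) :
    p • B j = ∑ i, op (leftMatrix B p i j) • B i := (sum_coords B (p • B j)).symm

theorem leftMatrix_eq {p : SkewPoly σ} {M : Matrix (Fin t) (Fin t) (Eigenring f)}
    (h : ∀ j, p • B j = ∑ i, op (M i j) • B i) : leftMatrix B p = M := by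
  ext i j
  have h1 := coords_sum B fun i => M i j
  rw [← h j] at h1
  exact congrFun h1 i

theorem leftMatrix_mul (p q : SkewPoly σ) :
    leftMatrix B (p * q) = leftMatrix B p * leftMatrix B q := by
  refine leftMatrix_eq B fun j => ?_
  rw [mul_smul, smul_basis B q, Finset.smul_sum]
  simp only [smul_comm p, smul_basis B p, Finset.smul_sum, Matrix.mul_apply, ← mul_smul, ← op_mul]
  rw [Finset.sum_comm]
  refine Finset.sum_congr rfl fun i _ => ?_
  rw [← Finset.sum_smul]
  congr 1
  exact (Finset.op_sum _ _).symm

theorem leftMatrix_add (p q : SkewPoly σ) :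
    leftMatrix B (p + q) = leftMatrix B p + leftMatrix B q := by
  ext i j
  simp only [leftMatrix, Matrix.of_apply, Matrix.add_apply, add_smul, map_add, Pi.add_apply]

theorem leftMatrix_smul (c : K) (p : SkewPoly σ) :
    leftMatrix B (c • p) = c • leftMatrix B p := by
  ext i j
  simp only [leftMatrix, Matrix.of_apply, Matrix.smul_apply, smul_assoc, coords_smul,
    Pi.smul_apply]

theorem leftMatrix_one : leftMatrix B 1 = 1 := by
  refine leftMatrix_eq B fun j => ?_
  rw [Finset.sum_eq_single j]
  · rw [Matrix.one_apply_eq, op_one, one_smul, one_smul]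
  · intro i _ hij
    rw [Matrix.one_apply_ne hij, op_zero, zero_smul]
  · simp

/-- Matrices of left multiplications as an algebra homomorphism. -/
def leftMatrixHom : SkewPoly σ →ₐ[K] Matrix (Fin t) (Fin t) (Eigenring f) :=
  AlgHom.ofLinearMap
    { toFun := leftMatrix B
      map_add' := leftMatrix_add B
      map_smul' := leftMatrix_smul B } (leftMatrix_one B) (leftMatrix_mul B)

theorem smul_eq_zero_of_basis {p : SkewPoly σ} (h : ∀ i, p • B i = 0) (v : LeftQuot f) :
    p • v = 0 := by
  have h1 : leftMul f p = 0 := B.ext fun i => by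
    rw [leftMul_apply, h i, LinearMap.zero_apply]
  rw [← leftMul_apply, h1, LinearMap.zero_apply]

/-- The columns are the coordinates of the images of the basis vectors, so their right span is the
image of left multiplication. -/
theorem rightRank_leftMatrix (p : SkewPoly σ) :
    rightRank (leftMatrix B p) =
      Module.finrank (Eigenring f)ᵐᵒᵖ (LinearMap.range (leftMul f p)) := by
  have hcol : Set.range (leftMatrix B p).col =
      (coords B : LeftQuot f →ₗ[(Eigenring f)ᵐᵒᵖ] (Fin t → Eigenring f)) ''
        (leftMul f p '' Set.range B) := by
    rw [← Set.range_comp, ← Set.range_comp]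
    rfl
  rw [rightRank, hcol, Submodule.span_image, Submodule.span_image, B.span_eq, Submodule.map_top]
  exact LinearEquiv.finrank_map_eq (coords B) _

theorem finrank_leftQuot_subfield {d : ℕ} (hd : f.HasDegree d) (k : Subfield K) :
    Module.finrank k (LeftQuot f) = d * Module.finrank k L := by
  rw [← Module.finrank_mul_finrank k L (LeftQuot f), finrank_leftQuot hd, mul_comm]

variable [FiniteDimensional K L]

theorem finite_leftQuot_base (hf : f ≠ 0) : Module.Finite K (LeftQuot f) :=
  have := finite_leftQuot hf
  Module.Finite.trans L (LeftQuot f)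

theorem finite_leftQuot_eigenring (hf : f ≠ 0) : Module.Finite (Eigenring f)ᵐᵒᵖ (LeftQuot f) :=
  have := finite_leftQuot_base hf
  Module.Finite.of_restrictScalars_finite K (Eigenring f)ᵐᵒᵖ (LeftQuot f)

theorem finite_eigenring (hf : f ≠ 0) : Module.Finite K (Eigenring f) := by
  have := finite_leftQuot_base hf
  let φ : Eigenring f →ₗ[K] LeftQuot f :=
    { toFun := fun α => op α • cls f 1
      map_add' := fun α β => by rw [op_add, add_smul]
      map_smul' := fun c α => by rw [op_smul, smul_assoc, RingHom.id_apply] }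
  exact Module.Finite.of_injective φ op_smul_cls_one_injective

include B in
theorem finrank_leftQuot_eq_mul (k : Subfield K) [FiniteDimensional k K] (hf : f ≠ 0) :
    Module.finrank k (LeftQuot f) = t * Module.finrank k (Eigenring f) := by
  have := finite_eigenring hf
  have : Module.Finite k (Eigenring f) := Module.Finite.trans K _
  have : Module.Free k (Eigenring f) := Module.Free.of_divisionRing k _
  rw [(coordsSubfield B k).finrank_eq, Module.finrank_pi_fintype]
  simp

variable [IsGalois K L] (hσ : Subgroup.zpowers σ = ⊤) {F : K[X]} (hFi : Irreducible F)
  (hF0 : F.coeff 0 ≠ 0) (hf : Irreducible f) (hfF : ∃ g, g * f = centralPoly σ F)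

include hσ hFi hF0 hf hfF

include B in
/-- Left multiplications on `R / R f` identify `R_F` with a power of `R / R f`. -/
theorem exists_linearEquiv_pi :
    Nonempty (LeftQuot (centralPoly σ F) ≃ₗ[SkewPoly σ] (Fin t → LeftQuot f)) := by
  let φ : SkewPoly σ →ₗ[SkewPoly σ] (Fin t → LeftQuot f) :=
    LinearMap.pi fun i => LinearMap.toSpanSingleton (SkewPoly σ) (LeftQuot f) (B i)
  have hφ : ∀ p i, φ p i = p • B i := fun p i => rfl
  have hsurj : Function.Surjective φ := fun w => by
    obtain ⟨p, hp⟩ := exists_smul_eq_of_linearIndependent hf B.linearIndependent w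
    exact ⟨p, funext fun i => by rw [hφ, hp]⟩
  have hker : LinearMap.ker φ = Ideal.span {centralPoly σ F} := by
    ext p
    rw [LinearMap.mem_ker]
    constructor
    · intro hp
      refine mem_span_centralPoly_of_smul_eq_zero hσ hFi hF0 hf hfF (smul_eq_zero_of_basis B ?_)
      exact fun i => by rw [← hφ, hp, Pi.zero_apply]
    · intro hp
      obtain ⟨q, rfl⟩ := Ideal.mem_span_singleton'.1 hp
      ext i
      rw [hφ, mul_smul, centralPoly_smul_eq_zero hfF, smul_zero, Pi.zero_apply]
  exact ⟨(Submodule.quotEquivOfEq _ _ hker.symm).trans (φ.quotKerEquivOfSurjective hsurj)⟩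

include B in
-- Compare lengths in `R_F ≅ (R / R f)^t`: the left side has length `m`, the right side `t`.
theorem eq_of_isProduct {m : ℕ} (hm : IsProductOfIrreducibles (centralPoly σ F) m) : t = m := by
  obtain ⟨e⟩ := exists_linearEquiv_pi B hσ hFi hF0 hf hfF
  have h := e.length_eq
  have := isSimpleModule_leftQuot hf
  rw [length_leftQuot_of_isProduct hm, Module.length_pi_of_fintype] at h
  simp only [Module.length_eq_one, Finset.sum_const, Finset.card_univ, Fintype.card_fin,
    nsmul_eq_mul, mul_one] at h
  exact_mod_cast h.symm

include B in
-- Compare `L`-dimensions in `R_F ≅ (R / R f)^t`.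
theorem natDegree_mul_finrank_eq {d : ℕ} (hd : f.HasDegree d) :
    F.natDegree * Module.finrank K L = t * d := by
  obtain ⟨e⟩ := exists_linearEquiv_pi B hσ hFi hF0 hf hfF
  have := finite_leftQuot (σ := σ) hf.ne_zero
  have h := (e.restrictScalars L).finrank_eq
  rw [finrank_leftQuot (hasDegree_centralPoly hFi.ne_zero), Module.finrank_pi_fintype,
    finrank_leftQuot hd] at h
  simpa using h

/-- Left multiplications on `R / R f` identify `R_F` with a matrix algebra over `E(f)`. -/
theorem exists_algEquiv :
    ∃ Φ : CentralQuot σ F ≃ₐ[K] Matrix (Fin t) (Fin t) (Eigenring f),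
      ∀ p, Φ (Ideal.Quotient.mk _ p) = leftMatrix B p := by
  have hker : ∀ p, p ∈ Ideal.span {centralPoly σ F} → leftMatrixHom B p = 0 := by
    intro p hp
    obtain ⟨q, rfl⟩ := Ideal.mem_span_singleton'.1 hp
    refine leftMatrix_eq B fun j => ?_
    rw [mul_smul, centralPoly_smul_eq_zero hfF, smul_zero]
    simp
  let φ : CentralQuot σ F →ₐ[K] Matrix (Fin t) (Fin t) (Eigenring f) :=
    Ideal.Quotient.liftₐ _ (leftMatrixHom B) hker
  have hφ : ∀ p, φ (Ideal.Quotient.mk _ p) = leftMatrix B p := fun p => rfl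
  refine ⟨AlgEquiv.ofBijective φ ⟨?_, fun M => ?_⟩, hφ⟩
  · refine (injective_iff_map_eq_zero φ).2 fun x hx => ?_
    obtain ⟨p, rfl⟩ := Ideal.Quotient.mk_surjective x
    rw [hφ] at hx
    refine Ideal.Quotient.eq_zero_iff_mem.2
      (mem_span_centralPoly_of_smul_eq_zero hσ hFi hF0 hf hfF (smul_eq_zero_of_basis B fun j => ?_))
    rw [smul_basis B, hx]
    simp
  · obtain ⟨p, hp⟩ := exists_smul_eq_of_linearIndependent hf B.linearIndependent
      fun j => ∑ i, op (M i j) • B i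
    exact ⟨Ideal.Quotient.mk _ p, (hφ p).trans (leftMatrix_eq B hp)⟩

theorem exists_basis {m : ℕ} (hm : IsProductOfIrreducibles (centralPoly σ F) m) :
    Nonempty (Module.Basis (Fin m) (Eigenring f)ᵐᵒᵖ (LeftQuot f)) := by
  have := nontrivial_eigenring_op hf
  have := finite_leftQuot_eigenring hf.ne_zero
  obtain ⟨t, ⟨B⟩⟩ := exists_basis_fin_of_isUnit_or_eq_zero (V := LeftQuot f)
    (isUnit_or_eq_zero_eigenring_op hf)
  exact ⟨B.reindex (finCongr (eq_of_isProduct B hσ hFi hF0 hf hfF hm))⟩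

end SkewPoly

namespace SkewPoly

variable {K L : Type*} [Field K] [Field L] [Algebra K L]

/-! ### Twisted polynomials -/

/-- `ρ` as an automorphism over `Fix(ρ) ∩ K`. -/
def fixedSubfieldEquiv (K : Type*) {L : Type*} [Field K] [Field L] [Algebra K L] (ρ : L ≃+* L) :
    L ≃ₐ[fixedSubfield K ρ] L :=
  AlgEquiv.ofRingEquiv (f := ρ) fun c => c.2

theorem norm_fixedSubfield_apply (ρ : L ≃+* L) (a : L) :
    Algebra.norm (fixedSubfield K ρ) (ρ a) = Algebra.norm (fixedSubfield K ρ) a :=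
  Algebra.norm_eq_of_algEquiv (fixedSubfieldEquiv K ρ) a

theorem smul_fixedSubfield (ρ : L ≃+* L) (c : fixedSubfield K ρ) (a : L) : ρ (c • a) = c • ρ a :=
  map_smul (fixedSubfieldEquiv K ρ) c a

variable (σ : L ≃ₐ[K] L) (ρ : L ≃+* L) (η : L) (D : ℕ) [NeZero D]

/-- The twisted polynomial `a₀ + a₁ x + ⋯ + a_{D-1} x^{D-1} + η ρ(a₀) x^D`. -/
def twistedMap : (Fin D → L) →ₗ[fixedSubfield K ρ] SkewPoly σ where
  toFun a := ofCoeffs σ D a + monomial σ D (η * ρ (a 0))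
  map_add' a b := by
    rw [map_add, Pi.add_apply, map_add, mul_add, monomial_add, add_add_add_comm]
  map_smul' c a := by
    have h1 : ofCoeffs σ D (c • a) = c • ofCoeffs σ D a :=
      map_smul ((ofCoeffs σ D).restrictScalars (fixedSubfield K ρ)) c a
    have h2 : monomial σ D (c • (η * ρ (a 0))) = c • monomial σ D (η * ρ (a 0)) := by
      rw [← one_smul L (monomial σ D (η * ρ (a 0))), ← smul_assoc, smul_monomial,
        smul_mul_assoc, one_mul]
    rw [RingHom.id_apply, smul_add, ← h1, ← h2, Pi.smul_apply, smul_fixedSubfield, mul_smul_comm]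

variable {σ D}

theorem coeff_twistedMap (a : Fin D → L) (i : Fin D) :
    coeff (twistedMap σ ρ η D a) i = a i := by
  show coeff (_ + _) _ = _
  rw [coeff_add, coeff_ofCoeffs, coeff_monomial, if_neg i.2.ne', add_zero]

theorem coeff_twistedMap_zero (a : Fin D → L) : coeff (twistedMap σ ρ η D a) 0 = a 0 :=
  coeff_twistedMap ρ η a 0

theorem coeff_twistedMap_self (a : Fin D → L) :
    coeff (twistedMap σ ρ η D a) D = η * ρ (a 0) := by
  show coeff (_ + _) _ = _
  rw [coeff_add, coeff_ofCoeffs_of_le _ le_rfl, coeff_monomial, if_pos rfl, zero_add]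

theorem coeff_twistedMap_of_lt (a : Fin D → L) {i : ℕ} (hi : D < i) :
    coeff (twistedMap σ ρ η D a) i = 0 := by
  show coeff (_ + _) _ = _
  rw [coeff_add, coeff_ofCoeffs_of_le _ hi.le, coeff_monomial, if_neg hi.ne, zero_add]

theorem twistedMap_injective : Function.Injective (twistedMap σ ρ η D) := fun a b h =>
  funext fun i => by rw [← coeff_twistedMap (σ := σ) ρ η a i, h, coeff_twistedMap]

theorem range_twistedMap : Set.range (twistedMap σ ρ η D) = twistedPolys σ ρ η D := by
  ext p
  constructor
  · rintro ⟨a, rfl⟩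
    refine ⟨fun i => if h : i < D then a ⟨i, h⟩ else 0, ?_⟩
    show ofCoeffs σ D a + _ = _
    rw [Finset.sum_range]
    simp [ofCoeffs, NeZero.pos D]
  · rintro ⟨a, rfl⟩
    refine ⟨fun i => a i, ?_⟩
    show ofCoeffs σ D _ + _ = _
    rw [Finset.sum_range]
    simp [ofCoeffs]

variable [FiniteDimensional K L] [IsGalois K L]

variable (hσ : Subgroup.zpowers σ = ⊤) {F : K[X]} (hFm : F.Monic) (hFi : Irreducible F)
  (hF0 : F.coeff 0 ≠ 0) {f : SkewPoly σ} (hf : Irreducible f) (hfF : ∃ g, g * f = centralPoly σ F)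
  [FiniteDimensional (fixedSubfield K ρ) K] {d k j : ℕ} (hd : f.HasDegree d) (hD : D = k * d)
  (hj : D = F.natDegree * j)
  (hnorm : Algebra.norm (fixedSubfield K ρ) η * Algebra.norm (fixedSubfield K ρ)
    ((-1) ^ (D * (Module.finrank K L - 1)) * F.coeff 0 ^ j) ≠ 1)

include hσ hFm hFi hF0 hj hnorm in
/-- Twisted polynomials of degree `D` do not divide `F(xⁿ)`. -/
theorem coeff_eq_zero_of_twistedMap_dvd (a : Fin D → L)
    (hdvd : ∃ g, g * twistedMap σ ρ η D a = centralPoly σ F) :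
    coeff (twistedMap σ ρ η D a) D = 0 := by
  by_contra hc
  set p := twistedMap σ ρ η D a with hp
  set c := coeff p D with hcdef
  have hcp : c = η * ρ (a 0) := coeff_twistedMap_self ρ η a
  have ha0 : a 0 ≠ 0 := fun h0 => hc (by rw [hcp, h0, map_zero, mul_zero])
  have hpdeg : p.HasDegree D := ⟨hc, fun i hi => coeff_twistedMap_of_lt ρ η a hi⟩
  have hdeg : (C σ c⁻¹ * p).HasDegree D := by
    have h := (hasDegree_monomial (σ := σ) 0 (inv_ne_zero hc)).mul hpdeg
    rwa [zero_add] at h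
  obtain ⟨i, hi, hnormi⟩ := norm_coeff_zero_of_dvd hσ hFm hFi hF0 hdeg
    (by rw [coeff_C_mul, ← hcdef, inv_mul_cancel₀ hc]) (by
      obtain ⟨g, hg⟩ := hdvd
      refine ⟨g * C σ c, ?_⟩
      rw [mul_assoc, ← mul_assoc (C σ c)]
      have h1 : C σ c * C σ c⁻¹ = 1 := by
        rw [← map_one (CHom σ), ← mul_inv_cancel₀ hc, map_mul]
        rfl
      rw [h1, one_mul, hg])
  -- The degree `D = s i = s j` fixes the exponent in the norm formula.
  have hij : i = j :=
    Nat.eq_of_mul_eq_mul_left hFi.natDegree_pos (hi.symm.trans hj)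
  subst hij
  rw [← hnormi, Algebra.norm_norm, coeff_C_mul, coeff_twistedMap_zero] at hnorm
  refine hnorm ?_
  have hfin : FiniteDimensional (fixedSubfield K ρ) L := Module.Finite.trans K L
  have hN0 : Algebra.norm (fixedSubfield K ρ) (a 0) ≠ 0 := Algebra.norm_ne_zero_iff.2 ha0
  -- The monic multiple has constant coefficient `c⁻¹ a₀` with `c = η ρ(a₀)`. Since `a₀` and `ρ(a₀)`
  -- have the same norm to `K'`, taking norms gives `N(η c⁻¹ a₀) = 1`, which is excluded.
  have h1 : η * (c⁻¹ * a 0) * ρ (a 0) = a 0 := by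
    rw [mul_assoc, mul_comm (c⁻¹ * a 0), ← mul_assoc, ← hcp, ← mul_assoc, mul_inv_cancel₀ hc,
      one_mul]
  have h2 := congrArg (Algebra.norm (fixedSubfield K ρ)) h1
  rw [map_mul, norm_fixedSubfield_apply, map_mul] at h2
  exact mul_right_cancel₀ hN0 (h2.trans (one_mul _).symm)

include hσ hFm hFi hF0 hf hfF hd hD hj hnorm

/-- A nonzero twisted polynomial of degree `k deg f` kills fewer than `k` independent vectors. -/
theorem eq_zero_of_twistedMap_smul_eq_zero {a : Fin D → L} {v : Fin k → LeftQuot f}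
    (hv : LinearIndependent (Eigenring f)ᵐᵒᵖ v) (h : ∀ i, twistedMap σ ρ η D a • v i = 0) :
    a = 0 := by
  by_contra ha
  set p := twistedMap σ ρ η D a with hp
  have hp0 : p ≠ 0 := fun h0 => ha (twistedMap_injective ρ η (h0.trans (map_zero _).symm))
  obtain ⟨e, he⟩ := exists_hasDegree hp0
  have := finite_leftQuot hp0
  have := finite_leftQuot hf.ne_zero
  let φ : SkewPoly σ →ₗ[SkewPoly σ] (Fin k → LeftQuot f) :=
    LinearMap.pi fun i => LinearMap.toSpanSingleton (SkewPoly σ) (LeftQuot f) (v i)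
  have hφ : ∀ q i, φ q i = q • v i := fun q i => rfl
  have hsurj : Function.Surjective φ := fun w => by
    obtain ⟨q, hq⟩ := exists_smul_eq_of_linearIndependent hf hv w
    exact ⟨q, funext fun i => by rw [hφ, hq]⟩
  have hle : Ideal.span {p} ≤ LinearMap.ker φ := by
    rw [Ideal.span_singleton_le_iff_mem, LinearMap.mem_ker]
    exact funext h
  let ψ : LeftQuot p →ₗ[L] (Fin k → LeftQuot f) :=
    (Submodule.liftQ (Ideal.span {p}) φ hle).restrictScalars L
  have hψ : ∀ q, ψ (cls p q) = φ q := fun q => rfl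
  have hψs : Function.Surjective ψ := fun w => by
    obtain ⟨q, hq⟩ := hsurj w
    exact ⟨cls p q, hq⟩
  have hpi : Module.finrank L (Fin k → LeftQuot f) = D := by
    rw [Module.finrank_pi_fintype, finrank_leftQuot hd, hD]
    simp
  -- The surjection onto a space of dimension `D` forces `deg p = D`, so it is an isomorphism.
  have hDe : D ≤ e := by
    rw [← hpi, ← finrank_leftQuot he]
    exact LinearMap.finrank_le_finrank_of_surjective hψs
  have hDe' : e = D := le_antisymm (not_lt.1 fun hlt => he.1 (coeff_twistedMap_of_lt ρ η a hlt)) hDe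
  have hψi : Function.Injective ψ :=
    (LinearMap.injective_iff_surjective_of_finrank_eq_finrank
      (by rw [finrank_leftQuot he, hpi, hDe'])).2 hψs
  -- `F(xⁿ)` kills each `vᵢ`, so by injectivity it lies in `R p`.
  have hF : cls p (centralPoly σ F) = 0 := by
    apply hψi
    rw [hψ, map_zero]
    funext i
    rw [hφ, centralPoly_smul_eq_zero hfF, Pi.zero_apply]
  obtain ⟨g, hg⟩ := Ideal.mem_span_singleton'.1 (cls_eq_zero.1 hF)
  exact he.1 (hDe' ▸ coeff_eq_zero_of_twistedMap_dvd ρ η hσ hFm hFi hF0 hj hnorm a ⟨g, hg⟩)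

/-- A nonzero twisted polynomial has kernel of dimension below `k`, so its rank is at least `m - k +
1`. A dimension count produces one of exactly that rank, and injectivity gives the size of the code.
-/
theorem isLinearMRDCode_twistedPolys {m : ℕ}
    (B : Module.Basis (Fin m) (Eigenring f)ᵐᵒᵖ (LeftQuot f)) (hk0 : 0 < k) (hkm : k ≤ m) :
    IsLinearMRDCode (fixedSubfield K ρ) (leftMatrix B '' twistedPolys σ ρ η D) (m - k + 1) := by
  have := finite_eigenring hf.ne_zero
  have := finite_leftQuot_base hf.ne_zero
  have := finite_leftQuot_eigenring hf.ne_zero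
  have := nontrivial_eigenring_op hf
  have hunit := isUnit_or_eq_zero_eigenring_op hf
  have hfinE : Module.Finite (fixedSubfield K ρ) (Eigenring f) := Module.Finite.trans K _
  have hfinM : Module.Finite (fixedSubfield K ρ) (LeftQuot f) := Module.Finite.trans K _
  have hfinL : Module.Finite (fixedSubfield K ρ) L := Module.Finite.trans K _
  have hLpos : 0 < Module.finrank (fixedSubfield K ρ) L := Module.finrank_pos
  have hdpos : 0 < d := Nat.pos_of_ne_zero fun h0 => NeZero.ne D (by rw [hD, h0, mul_zero])
  let Γ : (Fin D → L) →ₗ[fixedSubfield K ρ] Matrix (Fin m) (Fin m) (Eigenring f) :=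
    ((leftMatrixHom B).toLinearMap.restrictScalars (fixedSubfield K ρ)).comp (twistedMap σ ρ η D)
  have hΓ : ∀ a, Γ a = leftMatrix B (twistedMap σ ρ η D a) := fun a => rfl
  have hrange : leftMatrix B '' twistedPolys σ ρ η D = LinearMap.range Γ := by
    rw [← range_twistedMap, ← Set.range_comp]
    rfl
  have hrank : ∀ a, a ≠ 0 → m - k + 1 ≤ rightRank (Γ a) := by
    intro a ha
    by_contra hlt
    rw [hΓ, rightRank_leftMatrix] at hlt
    obtain ⟨v, hv, hv0⟩ := exists_linearIndependent_apply_eq_zero (k := k) hunit B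
      (leftMul f (twistedMap σ ρ η D a)) (by omega)
    exact ha (eq_zero_of_twistedMap_smul_eq_zero ρ η hσ hFm hFi hF0 hf hfF hd hD hj hnorm hv hv0)
  have hinj : Function.Injective Γ := (injective_iff_map_eq_zero Γ).2 fun a ha => by
    by_contra hne
    have h1 := hrank a hne
    have h2 : rightRank (Γ a) = 0 := by
      rw [ha, ← map_zero (leftMatrixHom B)]
      refine (rightRank_leftMatrix B 0).trans ?_
      have h3 : leftMul f 0 = 0 := LinearMap.ext fun v => zero_smul _ v
      rw [h3, LinearMap.range_zero]
      exact finrank_bot _ _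
    omega
  rw [hrange]
  refine ⟨hfinE, ⟨LinearMap.range Γ, rfl⟩, ⟨?_, ?_⟩, by omega, ?_⟩
  -- Killing `k - 1` basis vectors imposes `(k - 1) d [L : K']` linear conditions on a space of
  -- dimension `k d [L : K']`.
  · obtain ⟨a, ha, ha0⟩ : ∃ a : Fin D → L, a ≠ 0 ∧
        ∀ i : Fin (k - 1), twistedMap σ ρ η D a • B (Fin.castLE (by omega) i) = 0 := by
      let Θ : (Fin D → L) →ₗ[fixedSubfield K ρ] (Fin (k - 1) → LeftQuot f) :=
        (LinearMap.pi fun i => (LinearMap.toSpanSingleton (SkewPoly σ) (LeftQuot f)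
          (B (Fin.castLE (by omega) i))).restrictScalars (fixedSubfield K ρ)).comp
          (twistedMap σ ρ η D)
      have hΘ : ∀ a i, Θ a i = twistedMap σ ρ η D a • B (Fin.castLE (by omega) i) :=
        fun a i => rfl
      have hker : LinearMap.ker Θ ≠ ⊥ := by
        apply LinearMap.ker_ne_bot_of_finrank_lt
        rw [Module.finrank_pi_fintype, Module.finrank_pi_fintype, finrank_leftQuot_subfield hd]
        simp only [Finset.sum_const, Finset.card_univ, Fintype.card_fin, smul_eq_mul]
        rw [hD, ← mul_assoc]
        exact Nat.mul_lt_mul_of_pos_right (Nat.mul_lt_mul_of_pos_right (by omega) hdpos) hLpos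
      obtain ⟨a, haker, ha⟩ := (Submodule.ne_bot_iff _).1 hker
      exact ⟨a, ha, fun i => by rw [← hΘ, LinearMap.mem_ker.1 haker, Pi.zero_apply]⟩
    refine ⟨Γ a, ⟨a, rfl⟩, 0, ⟨0, map_zero Γ⟩, fun h0 => ha (hinj (h0.trans (map_zero Γ).symm)), ?_⟩
    rw [sub_zero]
    refine le_antisymm (hrank a ha) ?_
    rw [hΓ, rightRank_leftMatrix]
    have h1 := finrank_range_add_le hunit B (leftMul f (twistedMap σ ρ η D a))
      (B.linearIndependent.comp _ (Fin.castLE_injective (show k - 1 ≤ m by omega))) ha0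
    omega
  · rintro r ⟨A, ⟨a, rfl⟩, A', ⟨b, rfl⟩, hne, rfl⟩
    rw [← map_sub]
    exact hrank _ fun h0 => hne (by rw [sub_eq_zero.1 h0])
  · rw [Submodule.span_eq, LinearMap.finrank_range_of_inj hinj, Module.finrank_pi_fintype]
    have h1 := finrank_leftQuot_eq_mul B (fixedSubfield K ρ) hf.ne_zero
    rw [finrank_leftQuot_subfield hd] at h1
    simp only [Finset.sum_const, Finset.card_univ, Fintype.card_fin, smul_eq_mul]
    -- Both `d [L : K']` and `m [E(f) : K']` are the dimension of `R / R f`.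
    rw [hD, mul_assoc, h1, show m - (m - k + 1) + 1 = k by omega]
    ring

end SkewPoly

/-! ### Division products -/

section Products

variable {k V : Type*} [Field k] [AddCommGroup V] [Module k V]

theorem isDivisionProduct_of_eq_zero_or_eq_zero [FiniteDimensional k V]
    {star : V →ₗ[k] V →ₗ[k] V} (h : ∀ a b, star a b = 0 → a = 0 ∨ b = 0) :
    IsDivisionProduct star := by
  intro a ha
  have h1 : Function.Injective (star a) := (injective_iff_map_eq_zero _).2 fun b hb =>
    (h a b hb).resolve_left ha
  have h2 : Function.Injective (star.flip a) := (injective_iff_map_eq_zero _).2 fun b hb =>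
    (h b a hb).resolve_right ha
  exact ⟨⟨h1, LinearMap.surjective_of_injective h1⟩, ⟨h2, LinearMap.surjective_of_injective h2⟩⟩

/-- Kaplansky's trick: every division algebra is isotopic to a unital one. -/
theorem exists_unital_isotope [Nontrivial V] {star : V →ₗ[k] V →ₗ[k] V}
    (h : IsDivisionProduct star) :
    ∃ star₁ e, IsDivisionProduct star₁ ∧ IsUnity star₁ e ∧ IsIsotopic star₁ star := by
  obtain ⟨a, ha⟩ := exists_ne (0 : V)
  let l : V ≃ₗ[k] V := LinearEquiv.ofBijective (star a) (h a ha).1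
  let r : V ≃ₗ[k] V := LinearEquiv.ofBijective (star.flip a) (h a ha).2
  have hl : ∀ b, l b = star a b := fun b => rfl
  have hr : ∀ b, r b = star b a := fun b => rfl
  -- The new product of `b` and `c` is `R_a⁻¹(b) ⋆ L_a⁻¹(c)`, with unity `a ⋆ a`.
  let star₁ : V →ₗ[k] V →ₗ[k] V := star.compl₁₂ r.symm.toLinearMap l.symm.toLinearMap
  have hs : ∀ b c, star₁ b c = star (r.symm b) (l.symm c) := fun b c => rfl
  refine ⟨star₁, star a a, fun b hb => ⟨?_, ?_⟩, fun b => ⟨?_, ?_⟩,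
    LinearEquiv.refl k V, r.symm, l.symm, fun b c => hs b c⟩
  · exact (h (r.symm b) (by simpa using hb)).1.comp l.symm.bijective
  · exact (h (l.symm b) (by simpa using hb)).2.comp r.symm.bijective
  · rw [hs, ← hr a, r.symm_apply_apply, ← hl, l.apply_symm_apply]
  · rw [hs, ← hl a, l.symm_apply_apply, ← hr, r.apply_symm_apply]

theorem linearIndependent_const_of_ne_zero {D W : Type*} [Ring D] [Nontrivial D] [AddCommGroup W]
    [Module D W] (hD : ∀ a : D, IsUnit a ∨ a = 0) {v : W} (hv : v ≠ 0) :
    LinearIndependent D fun _ : Fin 1 => v := by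
  let _ := DivisionRing.ofIsUnitOrEqZero hD
  exact LinearIndependent.of_subsingleton 0 hv

end Products

namespace SkewPoly

variable {K L : Type*} [Field K] [Field L] [Algebra K L] {σ : L ≃ₐ[K] L} (ρ : L ≃+* L) (η : L)

/-! ### Twisted products on `R / R f` -/

theorem coeff_twistRep {f : SkewPoly σ} {d : ℕ} (a : ℕ → L) (i : ℕ) :
    coeff (twistRep ρ η f d a) i = if i = 0 then a 0 - η * ρ (a 0) * coeff f 0
      else if i < d then a i else 0 := by
  rw [twistRep, C, coeff_add, coeff_sum, coeff_monomial]
  simp only [coeff_monomial, Finset.sum_ite_eq', Finset.mem_Ico]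
  by_cases h : i = 0
  · subst h
    simp
  · rw [if_neg (Ne.symm h), if_neg h, zero_add]
    simp [Nat.one_le_iff_ne_zero, h]

/-- Adding `η ρ(a₀) f` restores the constant coefficient `a₀`, creates the top term `η ρ(a₀) x^d`,
and shifts the middle coefficients. So the lift is a twisted polynomial, and `twistRep` is its
remainder modulo `f`. -/
theorem twistLift_eq_twistedMap {f : SkewPoly σ} {d : ℕ} [NeZero d] (hd : f.HasDegree d)
    (hd1 : coeff f d = 1) {a : ℕ → L} {b : Fin d → L} (h0 : b 0 = a 0)
    (h : ∀ i : Fin d, (i : ℕ) ≠ 0 → b i = a i + η * ρ (a 0) * coeff f i) :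
    twistLift ρ η f d a = twistedMap σ ρ η d b := by
  have hdpos : 0 < d := NeZero.pos d
  refine ext fun i => ?_
  rw [twistLift, coeff_add, coeff_C_mul, coeff_twistRep]
  rcases lt_trichotomy i d with hi | rfl | hi
  · have h1 := coeff_twistedMap (σ := σ) ρ η b ⟨i, hi⟩
    simp only at h1
    rw [h1]
    by_cases hi0 : i = 0
    · subst hi0
      rw [if_pos rfl, sub_add_cancel]
      exact h0.symm
    · rw [if_neg hi0, if_pos hi, h ⟨i, hi⟩ hi0]
  · rw [coeff_twistedMap_self, if_neg hdpos.ne', if_neg (lt_irrefl _), hd1, h0, mul_one, zero_add]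
  · rw [coeff_twistedMap_of_lt ρ η b hi, if_neg (by omega), if_neg (by omega), hd.2 i hi, mul_zero,
      add_zero]

theorem cls_twistLift {f : SkewPoly σ} {d : ℕ} (a : ℕ → L) :
    cls f (twistLift ρ η f d a) = cls f (twistRep ρ η f d a) := by
  refine (Submodule.Quotient.eq _).2 ?_
  rw [twistLift, add_sub_cancel_left]
  exact Ideal.mem_span_singleton'.2 ⟨_, rfl⟩

variable {ρ η}

/-- The product `(u, v) ↦ l(u) w v` on `R / R f`. -/
def twistedProduct {f : SkewPoly σ} (l : LeftQuot f →ₗ[fixedSubfield K ρ] SkewPoly σ)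
    (w : SkewPoly σ) :
    LeftQuot f →ₗ[fixedSubfield K ρ] LeftQuot f →ₗ[fixedSubfield K ρ] LeftQuot f :=
  LinearMap.mk₂ _ (fun u v => l u • w • v)
    (fun u u' v => by rw [map_add, add_smul])
    (fun c u v => by rw [map_smul, smul_assoc])
    (fun u v v' => by rw [smul_add, smul_add])
    (fun c u v => by rw [smul_comm w c v, smul_comm (l u) c])

theorem twistedProduct_apply {f : SkewPoly σ}
    (l : LeftQuot f →ₗ[fixedSubfield K ρ] SkewPoly σ) (w : SkewPoly σ) (u v : LeftQuot f) :
    twistedProduct l w u v = l u • w • v := rfl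

theorem isTwistedProduct_twistedProduct {f : SkewPoly σ} {d : ℕ}
    {l : LeftQuot f →ₗ[fixedSubfield K ρ] SkewPoly σ}
    (hl : ∀ a, l (cls f (twistRep ρ η f d a)) = twistLift ρ η f d a) (w : SkewPoly σ) :
    IsTwistedProduct ρ η f w d (twistedProduct l w) := by
  intro a b
  rw [twistedProduct_apply, hl, smul_cls, smul_cls, mul_assoc]

theorem isTwistedProduct_unique {f w : SkewPoly σ} {d : ℕ}
    {star star₁ : LeftQuot f →ₗ[fixedSubfield K ρ] LeftQuot f →ₗ[fixedSubfield K ρ] LeftQuot f}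
    (hsurj : ∀ u, ∃ a, cls f (twistRep ρ η f d a) = u) (h : IsTwistedProduct ρ η f w d star)
    (h₁ : IsTwistedProduct ρ η f w d star₁) : star₁ = star := by
  refine LinearMap.ext₂ fun u v => ?_
  obtain ⟨a, rfl⟩ := hsurj u
  obtain ⟨b, rfl⟩ := cls_surjective f v
  rw [h, h₁]

theorem centralPoly_X_pow (s : ℕ) :
    centralPoly σ (Polynomial.X ^ s : K[X]) = X σ ^ (s * Module.finrank K L) := by
  rw [centralPoly_eq_aeval, map_pow, aeval_X, ← pow_mul, mul_comm]

variable [FiniteDimensional K L] [IsGalois K L]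

section CentralInverse

variable {F : K[X]} {f : SkewPoly σ}

theorem centralPoly_mem_center (G : K[X]) : centralPoly σ G ∈ Subring.center (SkewPoly σ) :=
  Subring.mem_center_iff.2 fun p => (centralPoly_comm σ G p).symm

/-- `F` is prime to `y^s` because `F₀ ≠ 0`. In `u F + v y^s = 1` evaluate at `xⁿ` and take `z =
v(xⁿ)`, since `F(xⁿ) ∈ R f`. -/
theorem exists_central_inverse (hFi : Irreducible F) (hF0 : F.coeff 0 ≠ 0)
    (hfF : ∃ g, g * f = centralPoly σ F) (s : ℕ) :
    ∃ z ∈ Subring.center (SkewPoly σ),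
      z * X σ ^ (s * Module.finrank K L) - 1 ∈ Ideal.span {f} := by
  have hnd : ¬F ∣ Polynomial.X ^ s := fun h => hF0 (by
    have h1 := hFi.dvd_symm irreducible_X (hFi.prime.dvd_of_dvd_pow h)
    exact X_dvd_iff.1 h1)
  obtain ⟨u, v, huv⟩ := (EuclideanDomain.dvd_or_coprime F (Polynomial.X ^ s) hFi).resolve_left hnd
  obtain ⟨g, hg⟩ := hfF
  refine ⟨centralPoly σ v, centralPoly_mem_center v, ?_⟩
  have h1 := congrArg (centralPoly σ) huv
  have h2 : centralPoly σ (1 : K[X]) = 1 := by rw [centralPoly_eq_aeval, map_one]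
  have h3 : centralPoly σ (u * F + v * Polynomial.X ^ s) =
      centralPoly σ (u * F) + centralPoly σ (v * Polynomial.X ^ s) := by
    simp only [centralPoly_eq_aeval, map_add]
  rw [h3, h2, centralPoly_mul, centralPoly_mul, centralPoly_X_pow] at h1
  rw [← h1, sub_add_cancel_right, ← hg, ← mul_assoc]
  exact neg_mem (Ideal.mem_span_singleton'.2 ⟨_, rfl⟩)

/-- A congruence modulo the left ideal `R f` may be multiplied by `b` only on the left; centrality
of `z x^(sn)` makes this enough. -/
theorem central_inverse_smul {z : SkewPoly σ} (hz : z ∈ Subring.center (SkewPoly σ)) {s : ℕ}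
    (h : z * X σ ^ (s * Module.finrank K L) - 1 ∈ Ideal.span {f}) (v : LeftQuot f) :
    (z * X σ ^ (s * Module.finrank K L)) • v = v := by
  obtain ⟨b, rfl⟩ := cls_surjective f v
  have hc : z * X σ ^ (s * Module.finrank K L) ∈ Subring.center (SkewPoly σ) := by
    rw [← centralPoly_X_pow]
    exact mul_mem hz (centralPoly_mem_center _)
  rw [smul_cls, ← Subring.mem_center_iff.1 hc b]
  refine (Submodule.Quotient.eq _).2 ?_
  have h1 := Ideal.mul_mem_left _ b h
  rwa [mul_sub, mul_one] at h1

end CentralInverse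

variable (hσ : Subgroup.zpowers σ = ⊤) {F : K[X]} (hFm : F.Monic) (hFi : Irreducible F)
  (hF0 : F.coeff 0 ≠ 0) {f : SkewPoly σ} (hf : Irreducible f) (hfF : ∃ g, g * f = centralPoly σ F)
  [FiniteDimensional (fixedSubfield K ρ) K] {d : ℕ} [NeZero d] (hd : f.HasDegree d)
  (hd1 : coeff f d = 1) (hnorm : Algebra.norm (fixedSubfield K ρ) (η * coeff f 0) ≠ 1)

include hσ hFm hFi hF0 hf hfF hd hd1 hnorm

/-- The twisted polynomials of degree `deg f` form a complement of `R f`, and act without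
zero divisors on `R / R f`. -/
theorem exists_twisted_section :
    ∃ l : LeftQuot f →ₗ[fixedSubfield K ρ] SkewPoly σ,
      (∀ u, cls f (l u) = u) ∧ Set.range l = twistedPolys σ ρ η d ∧
      (∀ u v : LeftQuot f, l u • v = 0 → u = 0 ∨ v = 0) ∧
      (∀ a, l (cls f (twistRep ρ η f d a)) = twistLift ρ η f d a) ∧
      ∀ u, ∃ a, cls f (twistRep ρ η f d a) = u := by
  obtain ⟨j, hj, hN⟩ := norm_coeff_zero_of_dvd hσ hFm hFi hF0 hd hd1 hfF
  have hnorm' : Algebra.norm (fixedSubfield K ρ) η * Algebra.norm (fixedSubfield K ρ)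
      ((-1) ^ (d * (Module.finrank K L - 1)) * F.coeff 0 ^ j) ≠ 1 := by
    rwa [← hN, Algebra.norm_norm, ← map_mul]
  have := nontrivial_eigenring_op hf
  have := finite_leftQuot_base hf.ne_zero
  have hfinM : Module.Finite (fixedSubfield K ρ) (LeftQuot f) := Module.Finite.trans K _
  have hfinL : Module.Finite (fixedSubfield K ρ) L := Module.Finite.trans K _
  -- The case `k = 1` of the kernel bound, for a single nonzero vector.
  have hzero : ∀ (a : Fin d → L) (v : LeftQuot f), v ≠ 0 → twistedMap σ ρ η d a • v = 0 →
      a = 0 := fun a v hv h =>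
    eq_zero_of_twistedMap_smul_eq_zero ρ η hσ hFm hFi hF0 hf hfF hd (one_mul d).symm hj hnorm'
      (linearIndependent_const_of_ne_zero (isUnit_or_eq_zero_eigenring_op hf) hv) fun _ => h
  let π : (Fin d → L) →ₗ[fixedSubfield K ρ] LeftQuot f :=
    ((Submodule.mkQ (Ideal.span {f})).restrictScalars (fixedSubfield K ρ)).comp
      (twistedMap σ ρ η d)
  have hπ : ∀ a, π a = cls f (twistedMap σ ρ η d a) := fun a => rfl
  -- A twisted polynomial in `R f` kills the class of `1`.
  have hπi : Function.Injective π := (injective_iff_map_eq_zero π).2 fun a ha =>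
    hzero a _ (cls_one_ne_zero hf) (by rw [smul_cls, mul_one, ← hπ, ha])
  let e : (Fin d → L) ≃ₗ[fixedSubfield K ρ] LeftQuot f :=
    LinearMap.linearEquivOfInjective π hπi (by
      rw [Module.finrank_pi_fintype, finrank_leftQuot_subfield hd]
      simp)
  have he : ∀ a, e a = cls f (twistedMap σ ρ η d a) := fun a => rfl
  let l : LeftQuot f →ₗ[fixedSubfield K ρ] SkewPoly σ :=
    (twistedMap σ ρ η d).comp e.symm.toLinearMap
  have hl : ∀ u, l u = twistedMap σ ρ η d (e.symm u) := fun u => rfl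
  refine ⟨l, fun u => ?_, ?_, fun u v h => ?_, fun a => ?_, fun u => ?_⟩
  · rw [hl, ← he, e.apply_symm_apply]
  · rw [← range_twistedMap]
    exact e.symm.surjective.range_comp (twistedMap σ ρ η d)
  · by_contra! hne
    have h1 := hzero _ v hne.2 h
    exact hne.1 ((LinearEquiv.map_eq_zero_iff _).1 h1)
  · have h1 : twistLift ρ η f d a = twistedMap σ ρ η d
        (fun i => if (i : ℕ) = 0 then a 0 else a i + η * ρ (a 0) * coeff f i) :=
      twistLift_eq_twistedMap ρ η hd hd1 (by simp) fun i hi => if_neg hi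
    rw [← cls_twistLift, h1, ← he, hl, e.symm_apply_apply]
  · let b := e.symm u
    -- These coefficients undo the shift of the middle coefficients by `η ρ(a₀) fᵢ`.
    refine ⟨fun i => if h : i < d then (if i = 0 then b 0 else
      b ⟨i, h⟩ - η * ρ (b 0) * coeff f i) else 0, ?_⟩
    rw [← cls_twistLift, twistLift_eq_twistedMap ρ η hd hd1 (b := b) (by simp [NeZero.pos d])
      (fun i hi => by simp [hi, NeZero.pos d]), ← he, e.apply_symm_apply]

end SkewPoly

/-! ### Isotopy, unity, numerical invariants and the final assembly. -/

namespace SkewPoly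

variable {K L : Type*} [Field K] [Field L] [Algebra K L] {σ : L ≃ₐ[K] L} {ρ : L ≃+* L} {η : L}

/-- The injective action of `w` is absorbed into the right factor. -/
theorem isIsotopic_twistedProduct [FiniteDimensional K L] [FiniteDimensional (fixedSubfield K ρ) K]
    {f : SkewPoly σ} (hf : f ≠ 0) (l : LeftQuot f →ₗ[fixedSubfield K ρ] SkewPoly σ)
    {w : SkewPoly σ} (hw : ∀ v : LeftQuot f, w • v = 0 → v = 0) :
    IsIsotopic (twistedProduct l w) (twistedProduct l 1) := by
  have := finite_leftQuot_base hf
  have hfinM : Module.Finite (fixedSubfield K ρ) (LeftQuot f) := Module.Finite.trans K _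
  let φ : LeftQuot f →ₗ[fixedSubfield K ρ] LeftQuot f :=
    { toFun := fun v => w • v
      map_add' := smul_add w
      map_smul' := fun c v => smul_comm w c v }
  refine ⟨LinearEquiv.refl _ _, LinearEquiv.refl _ _, LinearEquiv.ofInjectiveEndo φ
    ((injective_iff_map_eq_zero φ).2 hw), fun u v => ?_⟩
  show l u • w • v = l u • (1 : SkewPoly σ) • w • v
  rw [one_smul]

theorem twistRep_single_one {f : SkewPoly σ} {d : ℕ} (hd : 1 < d) :
    twistRep ρ η f d (Pi.single 1 1) = X σ := by
  refine ext fun i => ?_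
  rw [coeff_twistRep, X, coeff_monomial]
  by_cases h0 : i = 0
  · simp [h0]
  · rw [if_neg h0]
    by_cases h1 : i = 1
    · subst h1
      simp [hd]
    · simp [h1, Ne.symm h1]

/-- With `a₀ = 0` there is no twist. The bound `1 < d` makes `x` one of the untwisted terms, so `x`
is its own lift. -/
theorem twistLift_single_one {f : SkewPoly σ} {d : ℕ} (hd : 1 < d) :
    twistLift ρ η f d (Pi.single 1 1) = X σ := by
  have h0 : C σ (0 : L) = 0 := map_zero (CHom σ)
  rw [twistLift, twistRep_single_one hd]
  simp [h0]

theorem monic_coeff_zero_ne_zero {F : K[X]} (hFm : F.Monic) (hFi : Irreducible F)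
    (hFX : F ≠ Polynomial.X) : F.coeff 0 ≠ 0 := fun h0 =>
  hFX (eq_of_monic_of_associated hFm monic_X
    (irreducible_X.associated_of_dvd hFi (X_dvd_iff.2 h0)).symm)

variable [FiniteDimensional K L] [IsGalois K L] (hσ : Subgroup.zpowers σ = ⊤)
  {F : K[X]} (hFm : F.Monic) (hFi : Irreducible F)
  (hF0 : F.coeff 0 ≠ 0) {f : SkewPoly σ} (hf : Irreducible f) (hfF : ∃ g, g * f = centralPoly σ F)
  {d : ℕ} (hd : f.HasDegree d) (hd1 : coeff f d = 1)

include hσ hFm hFi hF0 hf hfF hd hd1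

theorem exists_twisted_products [FiniteDimensional (fixedSubfield K ρ) K] (hd0 : 0 < d)
    (hnorm : Algebra.norm (fixedSubfield K ρ) (η * coeff f 0) ≠ 1) {s : ℕ} (hs : 0 < s) :
    ∃ star : LeftQuot f →ₗ[fixedSubfield K ρ] LeftQuot f →ₗ[fixedSubfield K ρ] LeftQuot f,
      IsTwistedProduct ρ η f 1 d star ∧
      (∀ star₁, IsTwistedProduct ρ η f 1 d star₁ → star₁ = star) ∧
      IsDivisionProduct star ∧
      (Set.range fun (u : LeftQuot f) (v : LeftQuot f) => star u v) =
        (fun (p : SkewPoly σ) (v : LeftQuot f) => p • v) '' twistedPolys σ ρ η d ∧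
      (∃ star₁ e, IsDivisionProduct star₁ ∧ IsUnity star₁ e ∧ IsIsotopic star₁ star) ∧
      ∀ z ∈ Subring.center (SkewPoly σ),
        z * X σ ^ (s * Module.finrank K L) - 1 ∈ Ideal.span {f} →
        ∃ star' : LeftQuot f →ₗ[fixedSubfield K ρ] LeftQuot f →ₗ[fixedSubfield K ρ] LeftQuot f,
          IsTwistedProduct ρ η f (z * X σ ^ (s * Module.finrank K L - 1)) d star' ∧
          (∀ star₁, IsTwistedProduct ρ η f (z * X σ ^ (s * Module.finrank K L - 1)) d star₁ →
            star₁ = star') ∧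
          IsDivisionProduct star' ∧ IsIsotopic star' star ∧
          (1 < d → IsUnity star' (cls f (X σ))) := by
  have : NeZero d := ⟨hd0.ne'⟩
  have := finite_leftQuot_base hf.ne_zero
  have hfinM : Module.Finite (fixedSubfield K ρ) (LeftQuot f) := Module.Finite.trans K _
  have := nontrivial_leftQuot hf
  obtain ⟨l, hcls, hrange, hzero, hlift, hsurj⟩ :=
    exists_twisted_section hσ hFm hFi hF0 hf hfF hd hd1 hnorm
  have hdiv : ∀ w : SkewPoly σ, (∀ v : LeftQuot f, w • v = 0 → v = 0) →
      IsDivisionProduct (twistedProduct l w) := fun w hw =>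
    isDivisionProduct_of_eq_zero_or_eq_zero fun u v h => (hzero u _ h).imp_right (hw v)
  have hdiv1 := hdiv 1 fun v hv => by rwa [one_smul] at hv
  refine ⟨twistedProduct l 1, isTwistedProduct_twistedProduct hlift 1,
    fun star₁ h₁ => isTwistedProduct_unique hsurj (isTwistedProduct_twistedProduct hlift 1) h₁,
    hdiv1, ?_,
    exists_unital_isotope hdiv1, fun z hz hz1 => ?_⟩
  · rw [← hrange, ← Set.range_comp]
    congr 1
    funext u v
    rw [twistedProduct_apply, one_smul]
    rfl
  · set N := s * Module.finrank K L with hN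
    have hNpos : 0 < N := Nat.mul_pos hs Module.finrank_pos
    have hzX : z * X σ ^ (N - 1) * X σ = z * X σ ^ N := by
      rw [mul_assoc, ← pow_succ, Nat.sub_add_cancel hNpos]
    have hXz : X σ * (z * X σ ^ (N - 1)) = z * X σ ^ N := by
      rw [← mul_assoc, Subring.mem_center_iff.1 hz, mul_assoc, ← pow_succ',
        Nat.sub_add_cancel hNpos]
    have hinv := central_inverse_smul hz hz1
    have hw : ∀ v : LeftQuot f, (z * X σ ^ (N - 1)) • v = 0 → v = 0 := fun v hv => by
      rw [← hinv v, ← hXz, mul_smul, hv, smul_zero]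
    refine ⟨twistedProduct l (z * X σ ^ (N - 1)), isTwistedProduct_twistedProduct hlift _,
      fun star₁ h₁ => isTwistedProduct_unique hsurj (isTwistedProduct_twistedProduct hlift _) h₁,
      hdiv _ hw,
      isIsotopic_twistedProduct hf.ne_zero l hw, fun hd2 v => ⟨?_, ?_⟩⟩
    -- Both unit laws come from `x · z x^(sn-1) = z x^(sn-1) · x = z x^(sn)`, which acts as the
    -- identity.
    · have h1 := hlift (Pi.single 1 1)
      rw [twistRep_single_one hd2, twistLift_single_one hd2] at h1
      rw [twistedProduct_apply, h1, ← mul_smul, hXz, hinv]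
    · have h1 : (z * X σ ^ (N - 1)) • cls f (X σ) = cls f 1 := by
        rw [smul_cls, hzX, ← mul_one (z * X σ ^ N), ← smul_cls, hinv]
      rw [twistedProduct_apply, h1, smul_cls, mul_one, hcls]

/-- The numerical invariants of `f`. -/
theorem exists_degree_eq {m : ℕ} (hm : IsProductOfIrreducibles (centralPoly σ F) m) :
    Module.finrank K L = m * (Module.finrank K L / m) ∧ 0 < Module.finrank K L / m ∧
      d = F.natDegree * (Module.finrank K L / m) ∧
      Algebra.norm K (coeff f 0) =
        (-1) ^ (d * (Module.finrank K L - 1)) * F.coeff 0 ^ (Module.finrank K L / m) := by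
  obtain ⟨B⟩ := exists_basis hσ hFi hF0 hf hfF hm
  obtain ⟨j, hj, hN⟩ := norm_coeff_zero_of_dvd hσ hFm hFi hF0 hd hd1 hfF
  have h := natDegree_mul_finrank_eq B hσ hFi hF0 hf hfF hd
  have hn : 0 < Module.finrank K L := Module.finrank_pos
  -- From `s n = m d` and `d = s j`.
  have h1 : Module.finrank K L = m * j := by
    refine Nat.eq_of_mul_eq_mul_left hFi.natDegree_pos ?_
    rw [h, hj]
    ring
  have hm0 : 0 < m := Nat.pos_of_ne_zero fun h0 => by simp [h0] at h1; omega
  have hj0 : 0 < j := Nat.pos_of_ne_zero fun h0 => by simp [h0] at h1; omega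
  have h2 : Module.finrank K L / m = j := by rw [h1, Nat.mul_div_cancel_left _ hm0]
  rw [h2]
  exact ⟨h1, hj0, hj, hN⟩

omit hFm hd1 in
theorem exists_algEquiv_isLinearMRDCode [FiniteDimensional (fixedSubfield K ρ) K]
    (hFm : F.Monic) {s m ℓ : ℕ} (hs : s = F.natDegree) (hℓ : 0 < ℓ) (hdeg : d = s * ℓ)
    (B : Module.Basis (Fin m) (Eigenring f)ᵐᵒᵖ (LeftQuot f)) :
    ∃ Φ : CentralQuot σ F ≃ₐ[K] Matrix (Fin m) (Fin m) (Eigenring f),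
      (∀ (a : SkewPoly σ) (j : Fin m),
        a • B j = ∑ i, op (Φ (Ideal.Quotient.mk _ a) i j) • B i) ∧
      ∀ (k : ℕ) (η : L), 0 < k → k < m →
        Algebra.norm (fixedSubfield K ρ) η *
          Algebra.norm (fixedSubfield K ρ)
            ((-1) ^ (s * k * ℓ * (Module.finrank K L - 1)) * F.coeff 0 ^ (k * ℓ)) ≠ 1 →
        IsLinearMRDCode (fixedSubfield K ρ) (Φ '' twistedCode σ ρ η F (s * k * ℓ))
          (m - k + 1) := by
  obtain ⟨Φ, hΦ⟩ := exists_algEquiv B hσ hFi hF0 hf hfF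
  refine ⟨Φ, fun a j => ?_, fun k η hk hkm hnorm => ?_⟩
  · rw [hΦ]
    exact smul_basis B a j
  · have hs0 : 0 < s := hs ▸ hFi.natDegree_pos
    have : NeZero (s * k * ℓ) := ⟨(Nat.mul_pos (Nat.mul_pos hs0 hk) hℓ).ne'⟩
    have himage : Φ '' twistedCode σ ρ η F (s * k * ℓ) =
        leftMatrix B '' twistedPolys σ ρ η (s * k * ℓ) := by
      rw [twistedCode, Set.image_image]
      exact Set.image_congr fun p _ => hΦ p
    rw [himage]
    exact isLinearMRDCode_twistedPolys ρ η hσ hFm hFi hF0 hf hfF hd (by rw [hdeg]; ring)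
      (by rw [← hs]; ring) hnorm B hk hkm.le

end SkewPoly

end

theorem mainTheorem5 {K L : Type*} [Field K] [Field L] [Algebra K L] [FiniteDimensional K L]
    [IsGalois K L] (σ : L ≃ₐ[K] L) (hσ : Subgroup.zpowers σ = ⊤)
    (ρ : L ≃+* L) [FiniteDimensional (fixedSubfield K ρ) K]
    (F : K[X]) (hFm : F.Monic) (hFi : Irreducible F) (hFX : F ≠ Polynomial.X)
    (n s m ℓ : ℕ) (hn : n = Module.finrank K L) (hs : s = F.natDegree)
    (hm : IsProductOfIrreducibles (centralPoly σ F) m) (hℓ : ℓ = n / m)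
    (f : SkewPoly σ) (hfm : f.IsMonic) (hfi : Irreducible f)
    (hfF : ∃ g, g * f = centralPoly σ F) (hfZ : f ∉ Subring.center (SkewPoly σ)) :
    -- the setting: `n = mℓ`, `deg f = sℓ`, and `E(f)` is a division ring with `dim R/Rf = m`
    (n = m * ℓ ∧ f.HasDegree (s * ℓ)) ∧
    (Nontrivial (Eigenring f) ∧ ∀ α : Eigenring f, α ≠ 0 → IsUnit α) ∧
    Nonempty (Module.Basis (Fin m) (Eigenring f)ᵐᵒᵖ (LeftQuot f)) ∧
    -- the codes are MRD in `R_F ≅ M_m(E(f))`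
    (∀ B : Module.Basis (Fin m) (Eigenring f)ᵐᵒᵖ (LeftQuot f),
      ∃ Φ : CentralQuot σ F ≃ₐ[K] Matrix (Fin m) (Fin m) (Eigenring f),
        (∀ (a : SkewPoly σ) (j : Fin m),
          a • B j = ∑ i, op (Φ (Ideal.Quotient.mk _ a) i j) • B i) ∧
        ∀ (k : ℕ) (η : L), 0 < k → k < m →
          Algebra.norm (fixedSubfield K ρ) η *
            Algebra.norm (fixedSubfield K ρ)
              ((-1) ^ (s * k * ℓ * (n - 1)) * F.coeff 0 ^ (k * ℓ)) ≠ 1 →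
          IsLinearMRDCode (fixedSubfield K ρ) (Φ '' twistedCode σ ρ η F (s * k * ℓ))
            (m - k + 1)) ∧
    -- for `k = 1`: the division algebras on `R/Rf` and their unital isotopes
    (∀ η : L,
      Algebra.norm (fixedSubfield K ρ) η *
          Algebra.norm (fixedSubfield K ρ) ((-1) ^ (s * ℓ * (n - 1)) * F.coeff 0 ^ ℓ) =
        Algebra.norm (fixedSubfield K ρ) (η * f.coeff 0)) ∧
    (∀ η : L, Algebra.norm (fixedSubfield K ρ) (η * f.coeff 0) ≠ 1 →
      ∃ star : LeftQuot f →ₗ[fixedSubfield K ρ] LeftQuot f →ₗ[fixedSubfield K ρ] LeftQuot f,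
        IsTwistedProduct ρ η f 1 (s * ℓ) star ∧
        (∀ star₁, IsTwistedProduct ρ η f 1 (s * ℓ) star₁ → star₁ = star) ∧
        IsDivisionProduct star ∧
        Module.finrank (fixedSubfield K ρ) (LeftQuot f) =
          m * ℓ ^ 2 * s * Module.finrank (fixedSubfield K ρ) K ∧
        (Set.range fun (u : LeftQuot f) (v : LeftQuot f) => star u v) =
          (fun (p : SkewPoly σ) (v : LeftQuot f) => p • v) '' twistedPolys σ ρ η (s * ℓ) ∧
        (∃ star₁ e, IsDivisionProduct star₁ ∧ IsUnity star₁ e ∧ IsIsotopic star₁ star) ∧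
        (∃ z ∈ Subring.center (SkewPoly σ),
          z * SkewPoly.X σ ^ (s * n) - 1 ∈ Ideal.span {f}) ∧
        ∀ z ∈ Subring.center (SkewPoly σ),
          z * SkewPoly.X σ ^ (s * n) - 1 ∈ Ideal.span {f} →
          ∃ star' : LeftQuot f →ₗ[fixedSubfield K ρ] LeftQuot f →ₗ[fixedSubfield K ρ] LeftQuot f,
            IsTwistedProduct ρ η f (z * SkewPoly.X σ ^ (s * n - 1)) (s * ℓ) star' ∧
            (∀ star₁, IsTwistedProduct ρ η f (z * SkewPoly.X σ ^ (s * n - 1)) (s * ℓ) star₁ →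
              star₁ = star') ∧
            IsDivisionProduct star' ∧ IsIsotopic star' star ∧
            (1 < s * ℓ → IsUnity star' (cls f (SkewPoly.X σ)))) := by
  subst hn hs
  have hF0 := SkewPoly.monic_coeff_zero_ne_zero hFm hFi hFX
  obtain ⟨d, hd, hd1⟩ := hfm.exists_hasDegree
  obtain ⟨hnm, hℓ0, hdeg, hN⟩ := SkewPoly.exists_degree_eq hσ hFm hFi hF0 hfi hfF hd hd1 hm
  rw [← hℓ] at hnm hℓ0 hdeg hN
  have hs0 := hFi.natDegree_pos
  have hd0 : 0 < d := hdeg ▸ Nat.mul_pos hs0 hℓ0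
  subst hdeg
  refine ⟨⟨hnm, hd⟩, ⟨SkewPoly.nontrivial_eigenring hfi, fun α hα =>
    SkewPoly.isUnit_eigenring hfi hα⟩, SkewPoly.exists_basis hσ hFi hF0 hfi hfF hm, fun B =>
    SkewPoly.exists_algEquiv_isLinearMRDCode hσ hFi hF0 hfi hfF hd hFm rfl hℓ0 rfl B,
    fun η => ?_, fun η hη => ?_⟩
  · rw [← hN, Algebra.norm_norm, ← map_mul]
  · obtain ⟨star, h1, h2, h3, h4, h5, h6⟩ :=
      SkewPoly.exists_twisted_products hσ hFm hFi hF0 hfi hfF hd hd1 hd0 hη hs0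
    refine ⟨star, h1, h2, h3, ?_, h4, h5,
      SkewPoly.exists_central_inverse hFi hF0 hfF F.natDegree, h6⟩
    rw [SkewPoly.finrank_leftQuot_subfield hd,
      ← Module.finrank_mul_finrank (fixedSubfield K ρ) K L, hnm]
    ring
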